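/- Let $K$ be an algebraically closed field. For integers $p,q\ge 0$, $k\ge 2$, $1\le s\le k-1$ with $\gcd(s,k)=\gcd(s+2,k)=1$ and $\theta\in K\setminus\{0\}$, let $T_{p,q,k}$ be the Brauer graph consisting of a cycle with vertices $v_i$ and edges $e_i=\{v_i,v_{i+1}\}$ ($i\in\mathbb Z/k$), together with, at each $v_i$, $q$ inner edges $i_1,\dots,i_q$ and $p$ outer edges $i^1,\dots,i^p$ leading to end vertices, the clockwise order at $v_i$ being $e_i,i_1,\dots,i_q,e_{i-1},i^1,\dots,i^p$. Let $\sigma_s$ be the rotation with $\sigma_s(v_i)=v_{i+s}$, put $n(v_i)=e_i$, and for an end vertex $v$ let $n(v)$ be the edge at $v$. The order $p(T_{p,q,k},\sigma_s)$ on the pairs (edge, incident vertex) is obtained from the clockwise orders around the vertices by replacing, for every vertex $v$, the successor $n(v)$ at $v$ by $n(\sigma_s(v))=\sigma_s(n(v))$ at $\sigma_s(v)$. The quiver $Q(T_{p,q,k},\sigma_s)$ has the edges of $T_{p,q,k}$ as vertices and an arrow $i\to j$ whenever $j$ is a direct successor of $i$ in this order; arrows are composed from left to right. For an edge $i$ with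 end vertex $v$ let $C(i,v)$ be the path from $i$ to $\sigma_s(i)$ which starts at the pair $(i,v)$ and follows consecutive elements of the order up to the pair $(\sigma_s(i),\sigma_s(v))$. Then $\Lambda(p,q,k,s,\theta)$ is the quotient of the path algebra $KQ(T_{p,q,k},\sigma_s)$ by the ideal generated by 1. the products of two composable arrows $i_1\to i_2\to i_3$ such that $i_1,i_2,i_3$ are not consecutive in the order; 2. the elements $C(i,v)-C(i,w)$ for every edge $i=\{v,w\}\ne e_1$, and $C(e_1,v_1)-\theta\, C(e_1,v_2)$. Let $m_{k,s}$ be the unique integer with $1\le m_{k,s}\le k-1$ and $m_{k,s}(s+2)+1\equiv 0 \pmod k$. **Proposition.** Let $(p,q,k,s,\theta)$ and $(p',q',k',s',\theta')$ be two tuples of parameters satisfying the above conditions. The $K$-algebras $\Lambda(p,q,k,s,\theta)$ and $\Lambda(p',q',k',s',\theta')$ are isomorphic if and only if one of the following holds: (1) $p=p'$, $q=q'$, $k=k'$, $s=s'$, $\theta'=\theta$; (2) $p=q'$, $q=p'$, $k=k'$, $s\ne s'$, $m_{k,s}+m_{k',s'}=k-1$, $\theta'=\theta^{-1}$. -/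

import Mathlib

/-! ### Path algebras and bound quiver algebras

A quiver with finite vertex set `V` and set of arrows `A` is given by its source and target maps
`src tgt : A → V`.  Arrows are composed from left to right. -/

/-- The defining relations of the path algebra: the trivial paths are orthogonal idempotents with
sum `1`, and every arrow starts at its source and ends at its target. -/
inductive PathRel (K : Type*) [CommRing K] {V A : Type*} [Fintype V] (src tgt : A → V) :
    FreeAlgebra K (V ⊕ A) → FreeAlgebra K (V ⊕ A) → Prop
  | idem (v : V) : PathRel K src tgt
      (FreeAlgebra.ι K (Sum.inl v) * FreeAlgebra.ι K (Sum.inl v)) (FreeAlgebra.ι K (Sum.inl v))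
  | orth (v w : V) (h : v ≠ w) : PathRel K src tgt
      (FreeAlgebra.ι K (Sum.inl v) * FreeAlgebra.ι K (Sum.inl w)) 0
  | one : PathRel K src tgt (∑ v : V, FreeAlgebra.ι K (Sum.inl v)) 1
  | source (a : A) : PathRel K src tgt
      (FreeAlgebra.ι K (Sum.inl (src a)) * FreeAlgebra.ι K (Sum.inr a)) (FreeAlgebra.ι K (Sum.inr a))
  | target (a : A) : PathRel K src tgt
      (FreeAlgebra.ι K (Sum.inr a) * FreeAlgebra.ι K (Sum.inl (tgt a))) (FreeAlgebra.ι K (Sum.inr a))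

/-- The path algebra `KQ` of a quiver `Q` with finitely many vertices. -/
abbrev PathAlgebra (K : Type*) [CommRing K] {V A : Type*} [Fintype V] (src tgt : A → V) :=
  RingQuot (PathRel K src tgt)

/-- The element of the path algebra given by an arrow. -/
noncomputable def PathAlgebra.arrow (K : Type*) [CommRing K] {V A : Type*} [Fintype V]
    (src tgt : A → V) (a : A) : PathAlgebra K src tgt :=
  RingQuot.mkAlgHom K (PathRel K src tgt) (FreeAlgebra.ι K (Sum.inr a))

/-! ### The Brauer graph `T_{p,q,k}`

The vertices `v_i` (`i ∈ ℤ/k`) of the cycle are joined by the edges `e_i = {v_i, v_{i+1}}`.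
At `v_i` there are moreover `q` inner edges `i_1, …, i_q` and `p` outer edges `i^1, …, i^p`,
each ending in a further vertex which belongs to no other edge.
The clockwise order of the edges at `v_i` is `e_i, i_1, …, i_q, e_{i-1}, i^1, …, i^p`. -/

namespace BrauerT

/-- The vertices of `T_{p,q,k}`: the vertices `v_i` of the cycle, and the end vertices of the inner
and of the outer edges. The inner edges at `v_i` are numbered by `Fin q`, so that `l : Fin q`
stands for the edge `i_{l+1}`, and similarly for the outer edges. -/
inductive Vertex (p q k : ℕ) : Type
  | cyc (i : ZMod k)
  | innerEnd (i : ZMod k) (l : Fin q)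
  | outerEnd (i : ZMod k) (r : Fin p)

/-- The edges of `T_{p,q,k}`. -/
inductive Edge (p q k : ℕ) : Type
  | cyc (i : ZMod k)
  | inner (i : ZMod k) (l : Fin q)
  | outer (i : ZMod k) (r : Fin p)

/-- The incidences (half-edges) of `T_{p,q,k}`: pairs of an edge and one of its two vertices. -/
inductive Inc (p q k : ℕ) : Type
  /-- at `v_i`: the edge `e_i` for `j = 0`, the inner edge `i_j` for `j ≥ 1` -/
  | inn (i : ZMod k) (j : Fin (q + 1))
  /-- at `v_i`: the edge `e_{i-1}` for `j = 0`, the outer edge `i^j` for `j ≥ 1` -/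
  | out (i : ZMod k) (j : Fin (p + 1))
  /-- an inner edge at its end vertex -/
  | innEnd (i : ZMod k) (l : Fin q)
  /-- an outer edge at its end vertex -/
  | outEnd (i : ZMod k) (r : Fin p)

variable {p q k : ℕ}

/-- The edges form a finite set. -/
def edgeEquiv : Edge p q k ≃ ZMod k ⊕ (ZMod k × Fin q) ⊕ (ZMod k × Fin p) where
  toFun
    | .cyc i => .inl i
    | .inner i l => .inr (.inl (i, l))
    | .outer i r => .inr (.inr (i, r))
  invFun
    | .inl i => .cyc i
    | .inr (.inl (i, l)) => .inner i l
    | .inr (.inr (i, r)) => .outer i r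
  left_inv x := by cases x <;> rfl
  right_inv x := by rcases x with i | ⟨i, l⟩ | ⟨i, r⟩ <;> rfl

instance [NeZero k] : Fintype (Edge p q k) := Fintype.ofEquiv _ edgeEquiv.symm

/-- The edge of an incidence. -/
def Inc.edge : Inc p q k → Edge p q k
  | .inn i j => Fin.cases (.cyc i) (fun l => .inner i l) j
  | .out i j => Fin.cases (.cyc (i - 1)) (fun r => .outer i r) j
  | .innEnd i l => .inner i l
  | .outEnd i r => .outer i r

/-- The vertex of an incidence. -/
def Inc.vertex : Inc p q k → Vertex p q k
  | .inn i _ => .cyc i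
  | .out i _ => .cyc i
  | .innEnd i l => .innerEnd i l
  | .outEnd i r => .outerEnd i r

/-- The number of edges at the vertex of an incidence. -/
def Inc.valency : Inc p q k → ℕ
  | .inn _ _ => p + q + 2
  | .out _ _ => p + q + 2
  | .innEnd _ _ => 1
  | .outEnd _ _ => 1

/-- The direct successor in the circular (clockwise) order around a vertex of `T_{p,q,k}`. -/
def Inc.succ : Inc p q k → Inc p q k
  | .inn i j => if h : (j : ℕ) < q then .inn i ⟨j + 1, by omega⟩ else .out i 0
  | .out i j => if h : (j : ℕ) < p then .out i ⟨j + 1, by omega⟩ else .inn i 0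
  | .innEnd i l => .innEnd i l
  | .outEnd i r => .outEnd i r

/-- The rotation `σ_s` of `T_{p,q,k}`, acting on incidences: `σ_s(v_i) = v_{i+s}`. -/
def Inc.rot (s : ℕ) : Inc p q k → Inc p q k
  | .inn i j => .inn (i + s) j
  | .out i j => .out (i + s) j
  | .innEnd i l => .innEnd (i + s) l
  | .outEnd i r => .outEnd (i + s) r

/-- The distinguished edge `n(v)` at a vertex: `n(v_i) = e_i`, and for a vertex `v` off the cycle
it is the edge at `v` leading towards the cycle. -/
def Vertex.n : Vertex p q k → Edge p q k
  | .cyc i => .cyc i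
  | .innerEnd i l => .inner i l
  | .outerEnd i r => .outer i r

open Classical in
/-- The direct successor in the order `p(T, σ_s)`: the successor in the circular order around the
vertex `v`, except that `n(v)` (at `v`) is replaced by `n(σ_s(v)) = σ_s(n(v))` (at `σ_s(v)`). -/
noncomputable def Inc.next (s : ℕ) (h : Inc p q k) : Inc p q k :=
  if h.succ.edge = h.vertex.n then h.succ.rot s else h.succ

end BrauerT

/-! ### The algebra `Λ(p,q,k,s,θ)` -/

namespace BrauerT

/-- The path algebra of the generalized Brauer quiver `Q(T_{p,q,k}, σ_s)`: its vertices are the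
edges of `T_{p,q,k}`, and each incidence `h` gives an arrow from its edge to the edge of its direct
successor in the order `p(T, σ_s)`. -/
abbrev KQ (K : Type*) [Field K] (p q k s : ℕ) [NeZero k] :=
  PathAlgebra K (Inc.edge : Inc p q k → Edge p q k) (fun h => (h.next s).edge)

/-- The arrow from the edge of `h` to the edge of its direct successor. -/
noncomputable def arrow (K : Type*) [Field K] {p q k : ℕ} (s : ℕ) [NeZero k] (h : Inc p q k) :
    KQ K p q k s :=
  PathAlgebra.arrow K _ _ h

/-- For an incidence `h` of the edge `i` and the vertex `v`, the path `C(i, p(T, σ_s, v))` from `i`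
to `σ_s(i)` along consecutive elements of the order `p(T, σ_s, v)`. By `next_iterate_valency`
below it has as many arrows as there are edges at `v`. -/
noncomputable def C (K : Type*) [Field K] {p q k : ℕ} (s : ℕ) [NeZero k] (h : Inc p q k) :
    KQ K p q k s :=
  ((List.range h.valency).map fun n => arrow K s ((Inc.next s)^[n] h)).prod

/-- The generators of the ideal of relations, written as pairs of elements to be identified. -/
inductive Rel (K : Type*) [Field K] (p q k s : ℕ) [NeZero k] (θ : K) :
    KQ K p q k s → KQ K p q k s → Prop
  /-- composable arrows that do not come from consecutive elements of the order have product `0` -/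
  | zero (h h' : Inc p q k) (hcomp : (h.next s).edge = h'.edge) (hne : h.next s ≠ h') :
      Rel K p q k s θ (arrow K s h * arrow K s h') 0
  /-- for an edge `i = {v, w}` other than `e_1`, `C(i, v) = C(i, w)` -/
  | comm (h h' : Inc p q k) (hedge : h.edge = h'.edge) (hne : h ≠ h')
      (h1 : h.edge ≠ Edge.cyc 1) : Rel K p q k s θ (C K s h) (C K s h')
  /-- for the edge `e_1 = {v_1, v_2}`, `C(e_1, v_1) = θ C(e_1, v_2)` -/
  | comm_one : Rel K p q k s θ (C K s (Inc.inn 1 0)) (θ • C K s (Inc.out (1 + 1) 0))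

end BrauerT

/-- The algebra `Λ(p,q,k,s,θ)`, the bound quiver algebra of the generalized Brauer quiver of
`T_{p,q,k}` with respect to the rotation `σ_s`. -/
abbrev Lam (K : Type*) [Field K] (p q k s : ℕ) [NeZero k] (θ : K) :=
  RingQuot (BrauerT.Rel K p q k s θ)

/-- The integer `m_{k,s}`: the unique `m` with `1 ≤ m ≤ k - 1` and `m (s + 2) + 1 ≡ 0 (mod k)`
(see `mInt_unique`). -/
noncomputable def mInt (k s : ℕ) : ℕ :=
  sInf {m : ℕ | 1 ≤ m ∧ m ≤ k - 1 ∧ m * (s + 2) + 1 ≡ 0 [MOD k]}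

theorem exists_mInt {k s : ℕ} (hk : 2 ≤ k) (h : Nat.gcd (s + 2) k = 1) :
    ∃ m : ℕ, 1 ≤ m ∧ m ≤ k - 1 ∧ m * (s + 2) + 1 ≡ 0 [MOD k] := by
  have : NeZero k := ⟨by omega⟩
  have : Fact (1 < k) := ⟨hk⟩
  let u := ZMod.unitOfCoprime (s + 2) h
  have hu : (u : ZMod k) = s + 2 := by simp [u, ZMod.coe_unitOfCoprime]
  refine ⟨(-(↑u⁻¹ : ZMod k)).val, ?_, ?_, ?_⟩
  · rw [Nat.one_le_iff_ne_zero, Ne, ZMod.val_eq_zero, neg_eq_zero]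
    exact Units.ne_zero _
  · have := ZMod.val_lt (-(↑u⁻¹ : ZMod k))
    omega
  · rw [← ZMod.natCast_eq_natCast_iff]
    push_cast
    rw [ZMod.natCast_zmod_val, ← hu]
    simp

theorem mInt_spec {k s : ℕ} (hk : 2 ≤ k) (h : Nat.gcd (s + 2) k = 1) :
    1 ≤ mInt k s ∧ mInt k s ≤ k - 1 ∧ mInt k s * (s + 2) + 1 ≡ 0 [MOD k] :=
  Nat.sInf_mem (exists_mInt hk h)

theorem mInt_unique {k s m : ℕ} (hk : 2 ≤ k) (h : Nat.gcd (s + 2) k = 1)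
    (hm : 1 ≤ m ∧ m ≤ k - 1 ∧ m * (s + 2) + 1 ≡ 0 [MOD k]) : m = mInt k s := by
  obtain ⟨_, h2, h3⟩ := mInt_spec hk h
  have h4 : m * (s + 2) ≡ mInt k s * (s + 2) [MOD k] :=
    Nat.ModEq.add_right_cancel' 1 (hm.2.2.trans h3.symm)
  have h5 := Nat.ModEq.cancel_right_of_coprime (by rwa [Nat.gcd_comm]) h4
  exact Nat.ModEq.eq_of_lt_of_lt h5 (by omega) (by omega)

namespace BrauerT

variable {p q k : ℕ}

theorem next_inn_lt (s : ℕ) (i : ZMod k) (j : ℕ) (h : j < q) :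
    Inc.next s (.inn i ⟨j, by omega⟩ : Inc p q k) = .inn i ⟨j + 1, by omega⟩ := by
  have e : (.inn i ⟨j, by omega⟩ : Inc p q k).succ = .inn i ⟨j + 1, by omega⟩ := by
    simp [Inc.succ, h]
  have e' : (.inn i ⟨j + 1, by omega⟩ : Inc p q k).edge = .inner i ⟨j, h⟩ := rfl
  rw [Inc.next, e, e', if_neg (by simp [Inc.vertex, Vertex.n])]

theorem next_out_lt (s : ℕ) (i : ZMod k) (j : ℕ) (h : j < p) :
    Inc.next s (.out i ⟨j, by omega⟩ : Inc p q k) = .out i ⟨j + 1, by omega⟩ := by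
  have e : (.out i ⟨j, by omega⟩ : Inc p q k).succ = .out i ⟨j + 1, by omega⟩ := by
    simp [Inc.succ, h]
  have e' : (.out i ⟨j + 1, by omega⟩ : Inc p q k).edge = .outer i ⟨j, h⟩ := rfl
  rw [Inc.next, e, e', if_neg (by simp [Inc.vertex, Vertex.n])]

theorem next_inn_last (hk : 2 ≤ k) (s : ℕ) (i : ZMod k) :
    Inc.next s (.inn i ⟨q, by omega⟩ : Inc p q k) = .out i 0 := by
  have : Fact (1 < k) := ⟨hk⟩
  simp [Inc.next, Inc.succ, Inc.edge, Inc.vertex, Vertex.n]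

theorem next_out_last (s : ℕ) (i : ZMod k) :
    Inc.next s (.out i ⟨p, by omega⟩ : Inc p q k) = .inn (i + s) 0 := by
  simp [Inc.next, Inc.succ, Inc.edge, Inc.vertex, Vertex.n, Inc.rot]

theorem next_innEnd (s : ℕ) (i : ZMod k) (l : Fin q) :
    Inc.next s (.innEnd i l : Inc p q k) = .innEnd (i + s) l := by
  simp [Inc.next, Inc.succ, Inc.edge, Inc.vertex, Vertex.n, Inc.rot]

theorem next_outEnd (s : ℕ) (i : ZMod k) (r : Fin p) :
    Inc.next s (.outEnd i r : Inc p q k) = .outEnd (i + s) r := by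
  simp [Inc.next, Inc.succ, Inc.edge, Inc.vertex, Vertex.n, Inc.rot]

theorem iterate_inn (s : ℕ) (i : ZMod k) (n j : ℕ) (h : j + n ≤ q) :
    (Inc.next s)^[n] (.inn i ⟨j, by omega⟩ : Inc p q k) = .inn i ⟨j + n, by omega⟩ := by
  induction n generalizing j with
  | zero => rfl
  | succ n ih =>
    rw [Function.iterate_succ_apply, next_inn_lt s i j (by omega), ih (j + 1) (by omega)]
    congr 2; omega

theorem iterate_out (s : ℕ) (i : ZMod k) (n j : ℕ) (h : j + n ≤ p) :
    (Inc.next s)^[n] (.out i ⟨j, by omega⟩ : Inc p q k) = .out i ⟨j + n, by omega⟩ := by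
  induction n generalizing j with
  | zero => rfl
  | succ n ih =>
    rw [Function.iterate_succ_apply, next_out_lt s i j (by omega), ih (j + 1) (by omega)]
    congr 2; omega

/-- After as many steps as there are edges at the vertex, the order leads from `h` to `σ_s(h)`. -/
theorem next_iterate_valency (hk : 2 ≤ k) (s : ℕ) (h : Inc p q k) :
    (Inc.next s)^[h.valency] h = h.rot s := by
  rcases h with ⟨i, j, hj⟩ | ⟨i, j, hj⟩ | ⟨i, l⟩ | ⟨i, r⟩
  · have e : (Inc.inn i ⟨j, hj⟩ : Inc p q k).valency = j + (1 + (p + (1 + (q - j)))) := by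
      simp only [Inc.valency]; omega
    rw [e, Function.iterate_add_apply, Function.iterate_add_apply _ 1,
      Function.iterate_add_apply _ p, Function.iterate_add_apply _ 1, iterate_inn s i _ _ (by omega)]
    have : (⟨j + (q - j), by omega⟩ : Fin (q + 1)) = ⟨q, by omega⟩ := by ext; simp; omega
    rw [this, Function.iterate_one, next_inn_last hk]
    have h0 := iterate_out (p := p) (q := q) s i p 0 (by omega)
    simp only [Nat.zero_add] at h0
    rw [show (0 : Fin (p + 1)) = ⟨0, by omega⟩ from rfl, h0, next_out_last]
    have h1 := iterate_inn (p := p) (q := q) s (i + (s : ZMod k)) j 0 (by omega)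
    simp only [Nat.zero_add] at h1
    exact h1
  · have e : (Inc.out i ⟨j, hj⟩ : Inc p q k).valency = j + (1 + (q + (1 + (p - j)))) := by
      simp only [Inc.valency]; omega
    rw [e, Function.iterate_add_apply, Function.iterate_add_apply _ 1,
      Function.iterate_add_apply _ q, Function.iterate_add_apply _ 1, iterate_out s i _ _ (by omega)]
    have : (⟨j + (p - j), by omega⟩ : Fin (p + 1)) = ⟨p, by omega⟩ := by ext; simp; omega
    rw [this, Function.iterate_one, next_out_last]
    have h0 := iterate_inn (p := p) (q := q) s (i + (s : ZMod k)) q 0 (by omega)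
    simp only [Nat.zero_add] at h0
    rw [show (0 : Fin (q + 1)) = ⟨0, by omega⟩ from rfl, h0, next_inn_last hk]
    have h1 := iterate_out (p := p) (q := q) s (i + (s : ZMod k)) j 0 (by omega)
    simp only [Nat.zero_add] at h1
    exact h1
  · exact next_innEnd s i l
  · exact next_outEnd s i r

end BrauerT

/-! ### The classification of the algebras `Λ(p,q,k,s,θ)` -/

/-! Let J be the common kernel of all characters of Λ; isomorphisms preserve J and its powers. The
characters correspond to the edges of the graph (`edgeChar_bijective`), so an isomorphism permutes
these. An arrow at an end vertex equals a full path C(i,v) around a cycle vertex and lies in J².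
Give it degree p+q+2 and the arrows at cycle vertices ("central" ones) degree 1: all relations
become homogeneous. Since C(i,v) ≠ 0 (`pathProd_gen_valency_ne_zero`), a path of m ≤ p+q+2 central
arrows lies in J^m but not in J^(m+1) (`pathProd_notMem_charRad_pow`). No two central arrows are
parallel, because s+2 ≠ 0 in ℤ/k. Hence an isomorphism sends each of them, modulo J², to a nonzero
multiple of another, and induces a bijection of central incidences that commutes with `next`
(`exists_incIso`).

This bijection determines the discrete parameters. Counting gives k and p+q (`card_eq`); the gaps
q+1 and p+1 between successive incidences of cycle edges give p and q up to interchange; the pairing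
of the two incidences of each e_i gives s = s' in ℤ/k, or (s+1)(s'+1) = 1 if inner and outer are
interchanged (`map_inn_of_inn`, `map_inn_of_out`). The latter is the condition on m_{k,s}
(`mInt_add_mInt_eq_iff`).

For θ, compare leading coefficients in the relation at each e_i and multiply over all i: the scalars
of the arrows cancel (`prod_pathProd`), which leaves θ' = θ or θθ' = 1. Conversely, an affine
relabelling of ℤ/k that fixes e_1 and exchanges its two ends realises the second case (`swapEquiv`).
-/

namespace BrauerT

/-! ### Algebra homomorphisms out of `Λ(p,q,k,s,θ)` -/

section Lift

variable {p q k s : ℕ}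

/-- The product of the images of `m` consecutive arrows, starting with `h`. -/
noncomputable def pathProd {B : Type*} [Monoid B] (s : ℕ) (a : Inc p q k → B) : ℕ → Inc p q k → B
  | 0, _ => 1
  | m + 1, h => a h * pathProd s a m (h.next s)

theorem pathProd_eq_prod_range {B : Type*} [Monoid B] (a : Inc p q k → B) (m : ℕ)
    (h : Inc p q k) :
    ((List.range m).map fun n => a ((Inc.next s)^[n] h)).prod = pathProd s a m h := by
  induction m generalizing h with
  | zero => rfl
  | succ m ih =>
    rw [List.range_succ_eq_map, List.map_cons, List.prod_cons, List.map_map, pathProd, ← ih]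
    rfl

theorem pathProd_add {B : Type*} [Monoid B] (a : Inc p q k → B) (m n : ℕ) (h : Inc p q k) :
    pathProd s a (m + n) h = pathProd s a m h * pathProd s a n ((Inc.next s)^[m] h) := by
  induction m generalizing h with
  | zero => simp [pathProd]
  | succ m ih =>
    rw [Nat.add_right_comm, pathProd, ih, pathProd, mul_assoc, Function.iterate_succ_apply]

theorem map_pathProd {B B' : Type*} [Monoid B] [Monoid B'] {F : Type*} [FunLike F B B']
    [MonoidHomClass F B B'] (f : F) (a : Inc p q k → B) (m : ℕ) (h : Inc p q k) :
    f (pathProd s a m h) = pathProd s (fun g => f (a g)) m h := by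
  induction m generalizing h with
  | zero => simp [pathProd]
  | succ m ih => simp [pathProd, ih]

variable {K : Type*} [Field K] [NeZero k] {θ : K}

/-- Elements of an algebra `B` that satisfy the defining relations of `Λ(p,q,k,s,θ)`. -/
structure LamData (K : Type*) [Field K] (p q k s : ℕ) [NeZero k] (θ : K) (B : Type*) [Ring B] [Algebra K B] where
  e : Edge p q k → B
  a : Inc p q k → B
  idem : ∀ v, e v * e v = e v
  orth : ∀ v w, v ≠ w → e v * e w = 0
  one : ∑ v, e v = 1
  source : ∀ h : Inc p q k, e h.edge * a h = a h
  target : ∀ h : Inc p q k, a h * e (h.next s).edge = a h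
  zero : ∀ h h' : Inc p q k, (h.next s).edge = h'.edge → h.next s ≠ h' → a h * a h' = 0
  comm : ∀ h h' : Inc p q k, h.edge = h'.edge → h ≠ h' → h.edge ≠ .cyc 1 →
    pathProd s a h.valency h = pathProd s a h'.valency h'
  comm_one : pathProd s a (p + q + 2) (.inn 1 0) = θ • pathProd s a (p + q + 2) (.out (1 + 1) 0)

namespace LamData

variable {B : Type*} [Ring B] [Algebra K B] (D : LamData K p q k s θ B)

/-- The homomorphism from the path algebra. -/
noncomputable def liftPath : KQ K p q k s →ₐ[K] B :=
  RingQuot.liftAlgHom K ⟨FreeAlgebra.lift K (Sum.elim D.e D.a), by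
    intro x y r
    cases r with
    | idem v => simp [D.idem]
    | orth v w h => simp [D.orth v w h]
    | one => simp [D.one]
    | source h => simp [D.source]
    | target h => simp [D.target]⟩

theorem liftPath_arrow (h : Inc p q k) : D.liftPath (arrow K s h) = D.a h := by
  simp [liftPath, arrow, PathAlgebra.arrow, RingQuot.liftAlgHom_mkAlgHom_apply]

theorem liftPath_C (h : Inc p q k) : D.liftPath (C K s h) = pathProd s D.a h.valency h := by
  rw [C, pathProd_eq_prod_range, map_pathProd]
  simp only [liftPath_arrow]

/-- The homomorphism from `Λ(p,q,k,s,θ)` given by elements that satisfy the relations. -/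
noncomputable def liftQuot : Lam K p q k s θ →ₐ[K] B :=
  RingQuot.liftAlgHom K ⟨D.liftPath, by
    intro x y r
    cases r with
    | zero h h' hc hne => simp [liftPath_arrow, D.zero h h' hc hne]
    | comm h h' he hne h1 => rw [liftPath_C, liftPath_C, D.comm h h' he hne h1]
    | comm_one => rw [map_smul, liftPath_C, liftPath_C]; exact D.comm_one⟩

/-- The trivial paths and the arrows in `Λ(p,q,k,s,θ)`. -/
noncomputable def genQuot : LamData K p q k s θ (Lam K p q k s θ) :=
  let π : KQ K p q k s →ₐ[K] Lam K p q k s θ := RingQuot.mkAlgHom K (Rel K p q k s θ)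
  let ρ := RingQuot.mkAlgHom K
    (PathRel K (Inc.edge : Inc p q k → Edge p q k) (fun h => (h.next s).edge))
  have hC (h : Inc p q k) : pathProd s (fun h => π (arrow K s h)) h.valency h = π (C K s h) := by
    rw [C, pathProd_eq_prod_range, map_pathProd]
  { e := fun v => π (ρ (FreeAlgebra.ι K (Sum.inl v)))
    a := fun h => π (arrow K s h)
    idem := fun v => by
      rw [← map_mul, ← map_mul]; exact congrArg π (RingQuot.mkAlgHom_rel K (.idem v))
    orth := fun v w h => by
      rw [← map_mul, ← map_mul, RingQuot.mkAlgHom_rel K (PathRel.orth v w h), map_zero, map_zero]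
    one := by
      rw [← map_sum, ← map_sum, RingQuot.mkAlgHom_rel K PathRel.one, map_one, map_one]
    source := fun h => by
      rw [← map_mul]; unfold arrow PathAlgebra.arrow
      rw [← map_mul]; exact congrArg π (RingQuot.mkAlgHom_rel K (.source h))
    target := fun h => by
      rw [← map_mul]; unfold arrow PathAlgebra.arrow
      rw [← map_mul]; exact congrArg π (RingQuot.mkAlgHom_rel K (.target h))
    zero := fun h h' hc hne => by
      rw [← map_mul]
      exact (RingQuot.mkAlgHom_rel K (Rel.zero h h' hc hne)).trans (map_zero _)
    comm := fun h h' he hne h1 => by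
      rw [hC, hC]; exact RingQuot.mkAlgHom_rel K (Rel.comm h h' he hne h1)
    comm_one := by
      refine (hC (.inn 1 0)).trans (.trans ?_ (congrArg (θ • ·) (hC (.out (1 + 1) 0)).symm))
      exact (RingQuot.mkAlgHom_rel K Rel.comm_one).trans (map_smul _ _ _) }

theorem liftQuot_e (v : Edge p q k) : D.liftQuot (genQuot.e v) = D.e v := by
  simp [liftQuot, genQuot, liftPath, RingQuot.liftAlgHom_mkAlgHom_apply]

theorem liftQuot_a (h : Inc p q k) : D.liftQuot (genQuot.a h) = D.a h := by
  simp only [liftQuot, genQuot, RingQuot.liftAlgHom_mkAlgHom_apply]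
  exact D.liftPath_arrow h

theorem genQuot_induction {P : Lam K p q k s θ → Prop} (algebraMap : ∀ r, P (algebraMap K _ r))
    (e : ∀ v, P (genQuot.e v)) (a : ∀ h, P (genQuot.a h)) (add : ∀ x y, P x → P y → P (x + y))
    (mul : ∀ x y, P x → P y → P (x * y)) (x : Lam K p q k s θ) : P x := by
  obtain ⟨y, rfl⟩ := RingQuot.mkAlgHom_surjective K (Rel K p q k s θ) x
  obtain ⟨z, rfl⟩ := RingQuot.mkAlgHom_surjective K _ y
  induction z using FreeAlgebra.induction with
  | grade0 r => simpa using algebraMap r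
  | grade1 x =>
    rcases x with v | h
    · exact e v
    · exact a h
  | mul x y hx hy => simpa using mul _ _ hx hy
  | add x y hx hy => simpa using add _ _ hx hy

end LamData

/-- The algebra `Λ(p,q,k,s,θ)`, as a type of its own. -/
def LamRing (K : Type*) [Field K] (p q k s : ℕ) [NeZero k] (θ : K) : Type _ := Lam K p q k s θ

noncomputable instance : Ring (LamRing K p q k s θ) := inferInstanceAs (Ring (Lam K p q k s θ))

noncomputable instance : Algebra K (LamRing K p q k s θ) :=
  RingQuot.instAlgebra (Rel K p q k s θ)

namespace LamData

variable {B : Type*} [Ring B] [Algebra K B] (D : LamData K p q k s θ B)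

/-- The homomorphism from `Λ(p,q,k,s,θ)` given by elements that satisfy the relations. -/
noncomputable def lift : LamRing K p q k s θ →ₐ[K] B := D.liftQuot

/-- The trivial paths and the arrows in `Λ(p,q,k,s,θ)`. -/
noncomputable def gen : LamData K p q k s θ (LamRing K p q k s θ) := genQuot

@[simp]
theorem lift_e (v : Edge p q k) : D.lift (gen.e v) = D.e v := D.liftQuot_e v

@[simp]
theorem lift_a (h : Inc p q k) : D.lift (gen.a h) = D.a h := D.liftQuot_a h

theorem gen_induction {P : LamRing K p q k s θ → Prop} (algebraMap : ∀ r, P (algebraMap K _ r))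
    (e : ∀ v, P (gen.e v)) (a : ∀ h, P (gen.a h)) (add : ∀ x y, P x → P y → P (x + y))
    (mul : ∀ x y, P x → P y → P (x * y)) (x : LamRing K p q k s θ) : P x :=
  genQuot_induction algebraMap e a add mul x

theorem gen_hom_ext {f g : LamRing K p q k s θ →ₐ[K] B} (he : ∀ v, f (gen.e v) = g (gen.e v))
    (ha : ∀ h, f (gen.a h) = g (gen.a h)) : f = g := by
  refine AlgHom.ext fun x => gen_induction (P := fun x => f x = g x) (by simp) he ha
    (fun x y hx hy => by rw [map_add, map_add, hx, hy])
    (fun x y hx hy => by rw [map_mul, map_mul, hx, hy]) x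

theorem mul_eq_zero_of_next_ne {h h' : Inc p q k} (hne : h.next s ≠ h') : D.a h * D.a h' = 0 := by
  by_cases hc : (h.next s).edge = h'.edge
  · exact D.zero h h' hc hne
  · rw [← D.target h, ← D.source h', mul_assoc, ← mul_assoc (D.e _), D.orth _ _ hc]; simp

end LamData

end Lift

end BrauerT

/-! ### Valency and rotation along the order. -/

namespace BrauerT

variable {p q k s : ℕ}

theorem Inc.one_le_valency (h : Inc p q k) : 1 ≤ h.valency := by
  cases h <;> simp [Inc.valency]

theorem Inc.valency_rot (h : Inc p q k) : (h.rot s).valency = h.valency := by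
  cases h <;> rfl

theorem Inc.valency_succ (h : Inc p q k) : h.succ.valency = h.valency := by
  cases h <;> simp only [Inc.succ] <;> (try split_ifs) <;> rfl

theorem Inc.valency_next (h : Inc p q k) : (h.next s).valency = h.valency := by
  unfold Inc.next
  split_ifs
  · rw [valency_rot, valency_succ]
  · rw [valency_succ]

theorem Inc.rot_injective : Function.Injective (Inc.rot s : Inc p q k → Inc p q k) := by
  intro h h' e
  cases h <;> cases h' <;> simp_all [Inc.rot]

/-- The rotation `σ_s` on the edges. -/
def Edge.rot (s : ℕ) : Edge p q k → Edge p q k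
  | .cyc i => .cyc (i + s)
  | .inner i l => .inner (i + s) l
  | .outer i r => .outer (i + s) r

theorem Inc.edge_rot (h : Inc p q k) : (h.rot s).edge = h.edge.rot s := by
  rcases h with ⟨i, j⟩ | ⟨i, j⟩ | ⟨i, l⟩ | ⟨i, r⟩
  · refine Fin.cases ?_ (fun _ => ?_) j <;> rfl
  · refine Fin.cases ?_ (fun _ => ?_) j
    · simp [Inc.rot, Inc.edge, Edge.rot, sub_add_eq_add_sub]
    · rfl
  · rfl
  · rfl

/-! ### The paths `C(i,v)` do not vanish -/

variable (p q k) in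
/-- Names for paths: the trivial paths, the proper subpaths of the `C(i,v)` (the path named by
`mid h n` has `n + 1` arrows and can be continued by the arrow of `h`), and the `C(i,v)` up to
scalars (named by their target). -/
inductive PathState : Type
  | top (e : Edge p q k)
  -- The superfluous states with `n + 1 ≥ h.valency` are harmless: no arrow continues them.
  | mid (h : Inc p q k) (n : ℕ)
  | soc (e : Edge p q k)

/-- The target of a path. -/
def PathState.edge : PathState p q k → Edge p q k
  | .top e => e
  | .mid h _ => h.edge
  | .soc e => e

section

open Classical

variable {K : Type*} [Field K] (θ : K)

/-- The scalar attached to the target of `C(i,v)`. -/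
noncomputable def twist (s : ℕ) (h : Inc p q k) : K := if h = Inc.rot s (.inn 1 0) then θ else 1

/-- The value of `f` on the path with `n + 1` arrows which ends with the arrow of `h`. -/
noncomputable def landing (s : ℕ) (f : PathState p q k → K) (h : Inc p q k) (n : ℕ) : K :=
  if n + 1 < h.valency then f (.mid (h.next s) n) else
  if n + 1 = h.valency then twist θ s (h.next s) * f (.soc (h.next s).edge) else 0

/-- The action of the arrow of `h`. -/
noncomputable def arrowFun (s : ℕ) (h : Inc p q k) (f : PathState p q k → K) :
    PathState p q k → K
  -- The value of the new function at a path x is that of `f` at x followed by the arrow, so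
  -- products of operators match left-to-right composition of paths.
  | .top e => if h.edge = e then landing θ s f h 0 else 0
  | .mid g n => if g = h then landing θ s f h (n + 1) else 0
  | .soc _ => 0

/-- The action of the arrow of `h`, as a linear map. -/
noncomputable def arrowEnd (s : ℕ) (h : Inc p q k) : Module.End K (PathState p q k → K) where
  toFun := arrowFun θ s h
  map_add' f g := by
    ext (e | ⟨g, n⟩ | e) <;> simp only [arrowFun, landing, Pi.add_apply] <;>
      (try split_ifs) <;> ring
  map_smul' c f := by
    ext (e | ⟨g, n⟩ | e) <;>
      simp only [arrowFun, landing, Pi.smul_apply, RingHom.id_apply, smul_eq_mul] <;>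
      (try split_ifs) <;> ring

/-- The action of the trivial paths. -/
noncomputable def edgeEnd (e : Edge p q k) : Module.End K (PathState p q k → K) where
  toFun f x := if x.edge = e then f x else 0
  map_add' f g := by ext x; simp only [Pi.add_apply]; split_ifs <;> ring
  map_smul' c f := by
    ext x; simp only [Pi.smul_apply, RingHom.id_apply, smul_eq_mul]; split_ifs <;> ring

theorem edgeEnd_apply (e : Edge p q k) (f : PathState p q k → K) (x : PathState p q k) :
    edgeEnd e f x = if x.edge = e then f x else 0 := rfl

theorem arrowEnd_apply (h : Inc p q k) (f : PathState p q k → K) :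
    arrowEnd θ s h f = arrowFun θ s h f := rfl

theorem pathProd_arrowEnd_soc (m : ℕ) (h : Inc p q k) (f : PathState p q k → K) (e : Edge p q k) :
    pathProd s (arrowEnd θ s) (m + 1) h f (.soc e) = 0 := rfl

/-- Either the first arrow does not continue the path, or the total length exceeds the valency. -/
theorem pathProd_arrowEnd_mid_of_lt (m n : ℕ) (h g : Inc p q k) (f : PathState p q k → K)
    (hm : g = h → h.valency < n + 1 + (m + 1)) :
    pathProd s (arrowEnd θ s) (m + 1) h f (.mid g n) = 0 := by
  induction m generalizing h g n with
  | zero =>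
    simp only [pathProd, mul_one, arrowEnd_apply, arrowFun, landing]
    split_ifs with h1 h2 h3
    · have := hm h1; omega
    · have := hm h1; omega
    · rfl
    · rfl
  | succ m ih =>
    rw [pathProd, Module.End.mul_apply, arrowEnd_apply, arrowFun]
    split_ifs with h1
    · have := hm h1
      rw [landing]
      split_ifs with h2 h3
      · exact ih _ _ _ fun _ => by rw [Inc.valency_next]; omega
      · rw [pathProd_arrowEnd_soc, mul_zero]
      · rfl
    · rfl

theorem pathProd_arrowEnd_mid_of_eq (m n : ℕ) (h : Inc p q k) (f : PathState p q k → K)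
    (hm : n + 1 + (m + 1) = h.valency) :
    pathProd s (arrowEnd θ s) (m + 1) h f (.mid h n) =
      twist θ s ((Inc.next s)^[m + 1] h) * f (.soc ((Inc.next s)^[m + 1] h).edge) := by
  induction m generalizing h n with
  | zero => simp [pathProd, arrowEnd_apply, arrowFun, landing, hm]
  | succ m ih =>
    rw [pathProd, Module.End.mul_apply, arrowEnd_apply, arrowFun, if_pos rfl, landing,
      if_pos (by omega), ih (n + 1) _ (by rw [Inc.valency_next]; omega)]
    rfl

theorem pathProd_arrowEnd_top (hk : 2 ≤ k) (h : Inc p q k) (f : PathState p q k → K)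
    (e : Edge p q k) :
    pathProd s (arrowEnd θ s) h.valency h f (.top e) =
      if h.edge = e then twist θ s (h.rot s) * f (.soc (h.rot s).edge) else 0 := by
  rw [← next_iterate_valency hk s h]
  obtain ⟨m, hm⟩ : ∃ m, h.valency = m + 1 := ⟨h.valency - 1, by have := h.one_le_valency; omega⟩
  rw [hm, pathProd, Module.End.mul_apply, arrowEnd_apply, arrowFun]
  refine if_congr Iff.rfl ?_ rfl
  rcases m with _ | m
  · simp [landing, hm, pathProd]
  · rw [landing, if_pos (by omega),
      pathProd_arrowEnd_mid_of_eq θ m 0 _ _ (by rw [Inc.valency_next]; omega)]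
    rfl

/-- Apart from `twist`, the operator of C(i,v) depends only on the edge i. The commutativity
relations thus reduce to a comparison of twists. -/
theorem pathProd_arrowEnd (hk : 2 ≤ k) (h : Inc p q k) (f : PathState p q k → K)
    (x : PathState p q k) :
    pathProd s (arrowEnd θ s) h.valency h f x =
      if x = .top h.edge then twist θ s (h.rot s) * f (.soc (h.rot s).edge) else 0 := by
  obtain ⟨m, hm⟩ : ∃ m, h.valency = m + 1 := ⟨h.valency - 1, by have := h.one_le_valency; omega⟩
  rcases x with e | ⟨g, n⟩ | e
  · rw [pathProd_arrowEnd_top θ hk]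
    simp [eq_comm]
  · rw [if_neg (by simp), hm, pathProd_arrowEnd_mid_of_lt _ _ _ _ _ _ fun _ => by omega]
  · rw [if_neg (by simp), hm, pathProd_arrowEnd_soc]

theorem twist_of_ne (h : Inc p q k) (hne : h ≠ .inn 1 0) : twist θ s (h.rot s) = 1 :=
  if_neg fun e => hne (Inc.rot_injective e)

variable [NeZero k]

/-- The representation of `Λ(p,q,k,s,θ)` on the functions on `PathState p q k`. -/
noncomputable def pathRep (hk : 2 ≤ k) :
    LamData K p q k s θ (Module.End K (PathState p q k → K)) where
  e := edgeEnd
  a := arrowEnd θ s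
  idem v := by
    ext f x
    simp +contextual [Module.End.mul_apply, edgeEnd_apply]
  orth v w h := by
    refine LinearMap.ext fun f => funext fun x => ?_
    simp only [Module.End.mul_apply, edgeEnd_apply]
    split_ifs with h1 h2
    · exact absurd (h1.symm.trans h2) h
    · rfl
    · rfl
  one := by
    refine LinearMap.ext fun f => funext fun x => ?_
    simp [LinearMap.sum_apply, edgeEnd_apply]
  source h := by
    refine LinearMap.ext fun f => funext fun x => ?_
    simp only [Module.End.mul_apply, edgeEnd_apply, arrowEnd_apply]
    split_ifs with h1
    · rfl
    · rcases x with e | ⟨g, n⟩ | e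
      · exact (if_neg fun e => h1 e.symm).symm
      · exact (if_neg fun e => h1 (congrArg Inc.edge e)).symm
      · rfl
  target h := by
    refine LinearMap.ext fun f => funext fun x => ?_
    simp only [Module.End.mul_apply, arrowEnd_apply]
    rcases x with e | ⟨g, n⟩ | e <;> simp [arrowFun, landing, edgeEnd_apply, PathState.edge]
  zero h h' _ hne := by
    refine LinearMap.ext fun f => funext fun x => ?_
    simp only [Module.End.mul_apply, arrowEnd_apply]
    rcases x with e | ⟨g, n⟩ | e <;> simp [arrowFun, landing, hne]
  comm h h' he hne h1 := by
    refine LinearMap.ext fun f => funext fun x => ?_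
    rw [pathProd_arrowEnd θ hk, pathProd_arrowEnd θ hk, Inc.edge_rot, Inc.edge_rot, he,
      twist_of_ne, twist_of_ne]
    · rintro rfl; exact h1 (he.trans rfl)
    · rintro rfl; exact h1 rfl
  comm_one := by
    refine LinearMap.ext fun f => funext fun x => ?_
    have e1 := pathProd_arrowEnd (s := s) θ hk (.inn 1 0) f x
    have e2 := pathProd_arrowEnd (s := s) θ hk (.out (1 + 1) 0) f x
    have e3 : (.out (1 + 1) 0 : Inc p q k).edge = .cyc 1 := by simp [Inc.edge]
    have e4 : (.inn 1 0 : Inc p q k).edge = .cyc 1 := by simp [Inc.edge]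
    -- C(e_1,v_2) has twist 1 and C(e_1,v_1) has twist θ.
    rw [twist_of_ne θ _ (by simp), Inc.edge_rot, e3] at e2
    rw [Inc.edge_rot, e4, twist, if_pos rfl] at e1
    refine e1.trans ?_
    rw [LinearMap.smul_apply, Pi.smul_apply]
    erw [e2]
    simp

end

variable {K : Type*} [Field K] [NeZero k] {θ : K}

theorem pathProd_gen_valency_ne_zero (hk : 2 ≤ k) (hθ : θ ≠ 0) (h : Inc p q k) :
    pathProd s (LamData.gen (K := K) (s := s) (θ := θ)).a h.valency h ≠ 0 := by
  classical
  intro e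
  have e1 := congrArg (pathRep θ hk).lift e
  rw [map_pathProd, map_zero] at e1
  simp only [LamData.lift_a] at e1
  -- Applied to the constant function 1 and evaluated at the trivial path, C(i,v) gives its twist,
  -- which is θ or 1.
  have e2 := congrFun (LinearMap.congr_fun e1 fun _ => 1) (.top h.edge)
  erw [pathProd_arrowEnd θ hk] at e2
  simp only [if_true, mul_one, twist] at e2
  split_ifs at e2
  · exact hθ e2
  · exact one_ne_zero e2

end BrauerT

open Polynomial

/-! ### The common kernel of the characters of an algebra -/

section CharRad

variable (K A B : Type*) [Field K] [Ring A] [Algebra K A] [Ring B] [Algebra K B]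

/-- The intersection of the kernels of all characters `A → K`. -/
def charRad : Submodule K A := ⨅ χ : A →ₐ[K] K, LinearMap.ker χ.toLinearMap

variable {K A B}

theorem mem_charRad {x : A} : x ∈ charRad K A ↔ ∀ χ : A →ₐ[K] K, χ x = 0 := by
  simp [charRad, Submodule.mem_iInf]

/-- The exponent must be positive: as a power of submodules, the zeroth power is K·1 and not the
whole algebra. -/
theorem mul_mem_charRad_pow_left {n : ℕ} {x : A} (y : A) (hx : x ∈ charRad K A ^ (n + 1)) :
    y * x ∈ charRad K A ^ (n + 1) := by
  have h : (⊤ : Submodule K A) * charRad K A ≤ charRad K A :=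
    Submodule.mul_le.2 fun a _ b hb => mem_charRad.2 fun χ => by
      rw [map_mul, mem_charRad.1 hb χ, mul_zero]
  rw [pow_succ'] at hx ⊢
  have := Submodule.mul_mem_mul (Submodule.mem_top (x := y)) hx
  rw [← mul_assoc] at this
  exact mul_le_mul' h le_rfl this

theorem mul_mem_charRad_pow_right {n : ℕ} {x : A} (y : A) (hx : x ∈ charRad K A ^ (n + 1)) :
    x * y ∈ charRad K A ^ (n + 1) := by
  have h : charRad K A * (⊤ : Submodule K A) ≤ charRad K A :=
    Submodule.mul_le.2 fun a ha b _ => mem_charRad.2 fun χ => by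
      rw [map_mul, mem_charRad.1 ha χ, zero_mul]
  rw [pow_succ] at hx ⊢
  have := Submodule.mul_mem_mul hx (Submodule.mem_top (x := y))
  rw [mul_assoc] at this
  exact mul_le_mul' le_rfl h this

theorem charRad_pow_antitone {m n : ℕ} (h : m ≤ n) (hm : 1 ≤ m) {x : A}
    (hx : x ∈ charRad K A ^ n) : x ∈ charRad K A ^ m := by
  obtain ⟨m, rfl⟩ := Nat.exists_eq_add_of_le' hm
  obtain ⟨d, rfl⟩ := Nat.exists_eq_add_of_le' h
  rw [pow_add] at hx
  exact (Submodule.mul_le.2 fun a _ b hb => mul_mem_charRad_pow_left a hb) hx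

/-- Characters of `B` pull back along `φ`. This makes the J-adic filtration an invariant of the
algebra. -/
theorem AlgEquiv.map_mem_charRad_pow (φ : A ≃ₐ[K] B) (n : ℕ) {x : A}
    (hx : x ∈ charRad K A ^ n) : φ x ∈ charRad K B ^ n := by
  have h : (charRad K A).map φ.toAlgHom.toLinearMap ≤ charRad K B := by
    rintro _ ⟨y, hy, rfl⟩
    exact mem_charRad.2 fun χ => mem_charRad.1 hy (χ.comp φ.toAlgHom)
  have h2 : φ x ∈ (charRad K A ^ n).map φ.toAlgHom.toLinearMap := ⟨x, hx, rfl⟩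
  rw [Submodule.map_pow] at h2
  exact pow_le_pow_left' h n h2

end CharRad

/-! ### Arithmetic conditions and central incidences. -/

namespace BrauerT

/-- The conditions on `k` and `s`. -/
structure Admissible (k s : ℕ) : Prop where
  two_le : 2 ≤ k
  isUnit : IsUnit (s : ZMod k)
  isUnit_add_two : IsUnit ((s : ZMod k) + 2)

variable {p q k s : ℕ}

/-- The incidences at the vertices of the cycle. -/
def Inc.IsCentral (h : Inc p q k) : Prop := h.valency = p + q + 2

theorem Inc.IsCentral.next {h : Inc p q k} (hh : h.IsCentral) : (h.next s).IsCentral :=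
  h.valency_next.trans hh

theorem pathProd_ne_zero {K : Type*} [Field K] (c : Inc p q k → K) (hc : ∀ h, h.IsCentral → c h ≠ 0) (m : ℕ)
    {h : Inc p q k} (hh : h.IsCentral) : pathProd s c m h ≠ 0 := by
  induction m generalizing h with
  | zero => exact one_ne_zero
  | succ m ih => exact mul_ne_zero (hc h hh) (ih hh.next)

/-- Makes every arrow square to zero, so that all characters kill it. At end vertices this needs s ≠
0 in ℤ/k. -/
theorem next_ne_self (ad : Admissible k s) (h : Inc p q k) : h.next s ≠ h := by
  have : Fact (1 < k) := ⟨ad.two_le⟩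
  have hs : (s : ZMod k) ≠ 0 := ad.isUnit.ne_zero
  rcases h with ⟨i, j, hj⟩ | ⟨i, j, hj⟩ | ⟨i, l⟩ | ⟨i, r⟩
  · rcases (Nat.lt_succ_iff.1 hj).lt_or_eq with h | rfl
    · rw [next_inn_lt s i j h]; simp
    · rw [next_inn_last ad.two_le]; simp
  · rcases (Nat.lt_succ_iff.1 hj).lt_or_eq with h | rfl
    · rw [next_out_lt s i j h]; simp
    · rw [next_out_last]; simp
  · rw [next_innEnd]; simp [hs]
  · rw [next_outEnd]; simp [hs]

/-! ### Degrees for which the relations are homogeneous. -/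

section Degree

open Classical

/-- The degree of an arrow. -/
noncomputable def Inc.degree (h : Inc p q k) : ℕ := if h.IsCentral then 1 else p + q + 2

theorem Inc.degree_next (h : Inc p q k) : (h.next s).degree = h.degree := by
  rw [degree, degree, IsCentral, IsCentral, valency_next]

/-- All paths C(i,v) have the same degree, so the commutativity relations are homogeneous. -/
theorem Inc.valency_mul_degree (h : Inc p q k) : h.valency * h.degree = p + q + 2 := by
  rcases h with ⟨i, j⟩ | ⟨i, j⟩ | ⟨i, l⟩ | ⟨i, r⟩ <;> simp [degree, IsCentral, valency]

theorem pathProd_monomial {B : Type*} [Ring B] (a : Inc p q k → B) (m : ℕ) (h : Inc p q k) :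
    pathProd s (fun g => monomial g.degree (a g)) m h =
      monomial (m * h.degree) (pathProd s a m h) := by
  induction m generalizing h with
  | zero => simp [pathProd]
  | succ m ih =>
    rw [pathProd, ih, monomial_mul_monomial, pathProd, Inc.degree_next]
    rw [Nat.succ_mul, Nat.add_comm]

end Degree

/-! ### Characters and the filtration by powers of their common kernel. -/

section Characters

open Classical

variable {K : Type*} [Field K] {θ : K}

theorem pathProd_zero {B : Type*} [MonoidWithZero B] (m : ℕ) (hm : 1 ≤ m) (h : Inc p q k) :
    pathProd s (fun _ => (0 : B)) m h = 0 := by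
  obtain ⟨m, rfl⟩ := Nat.exists_eq_add_of_le' hm
  rw [pathProd, zero_mul]

variable [NeZero k]

/-- The character of `Λ(p,q,k,s,θ)` given by a vertex of the quiver. -/
noncomputable def edgeCharData (v : Edge p q k) : LamData K p q k s θ K where
  e w := if w = v then 1 else 0
  a _ := 0
  idem w := by simp
  orth w w' h := by
    by_cases h1 : w = v
    · rw [if_neg (h1 ▸ h.symm : ¬ w' = v), mul_zero]
    · rw [if_neg h1, zero_mul]
  one := by simp
  source h := by simp
  target h := by simp
  zero h h' _ _ := by simp
  comm h h' _ _ _ := by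
    rw [pathProd_zero _ h.one_le_valency, pathProd_zero _ h'.one_le_valency]
  comm_one := by simp [pathProd_zero]

variable (s θ) in
/-- The character of `Λ(p,q,k,s,θ)` given by a vertex of the quiver. -/
noncomputable def edgeChar (v : Edge p q k) : LamRing K p q k s θ →ₐ[K] K := (edgeCharData v).lift

theorem edgeChar_e (v w : Edge p q k) :
    edgeChar s θ v (LamData.gen.e w) = if w = v then 1 else 0 := LamData.lift_e _ _

theorem edgeChar_a (v : Edge p q k) (h : Inc p q k) : edgeChar s θ v (LamData.gen.a h) = 0 :=
  LamData.lift_a _ _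

theorem char_a (ad : Admissible k s) (χ : LamRing K p q k s θ →ₐ[K] K) (h : Inc p q k) :
    χ (LamData.gen.a h) = 0 := by
  have : χ (LamData.gen.a h * LamData.gen.a h) = 0 := by
    rw [LamData.gen.mul_eq_zero_of_next_ne (next_ne_self ad h), map_zero]
  rw [map_mul] at this
  exact mul_self_eq_zero.1 this

/-- A character kills the arrows, and since the trivial paths are orthogonal idempotents with sum 1,
exactly one of them survives, with value 1. -/
theorem edgeChar_bijective (ad : Admissible k s) :
    Function.Bijective (edgeChar s θ : Edge p q k → (LamRing K p q k s θ →ₐ[K] K)) := by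
  constructor
  · intro v w h
    have := AlgHom.congr_fun h (LamData.gen.e v)
    rw [edgeChar_e, edgeChar_e, if_pos rfl] at this
    by_contra hne
    rw [if_neg hne] at this
    exact one_ne_zero this
  · intro χ
    obtain ⟨v, hv⟩ : ∃ v : Edge p q k, χ (LamData.gen.e v) ≠ 0 := by
      by_contra! h
      have := congrArg χ (LamData.gen (K := K) (p := p) (q := q) (k := k) (s := s) (θ := θ)).one
      rw [map_sum, map_one, Finset.sum_eq_zero fun v _ => h v] at this
      exact zero_ne_one this
    refine ⟨v, LamData.gen_hom_ext (fun w => ?_) fun h => ?_⟩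
    · rw [edgeChar_e]
      split_ifs with h
      · subst h
        have := congrArg χ (LamData.gen.idem w)
        rw [map_mul] at this
        exact (mul_right_cancel₀ hv (this.trans (one_mul _).symm)).symm
      · have := congrArg χ (LamData.gen.orth w v h)
        rw [map_mul, map_zero] at this
        exact ((mul_eq_zero.1 this).resolve_right hv).symm
    · rw [edgeChar_a, char_a ad]

theorem mem_charRad_iff (ad : Admissible k s) {x : LamRing K p q k s θ} :
    x ∈ charRad K (LamRing K p q k s θ) ↔ ∀ v, edgeChar s θ v x = 0 := by
  rw [mem_charRad]
  exact (edgeChar_bijective ad).surjective.forall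

theorem a_mem_charRad (ad : Admissible k s) (h : Inc p q k) :
    LamData.gen.a h ∈ charRad K (LamRing K p q k s θ) :=
  mem_charRad.2 fun χ => char_a ad χ h

theorem pathProd_mem_charRad_pow (ad : Admissible k s) (m : ℕ) (h : Inc p q k) :
    pathProd s LamData.gen.a m h ∈ charRad K (LamRing K p q k s θ) ^ m := by
  induction m generalizing h with
  | zero => simp only [pathProd, pow_zero]; exact Submodule.one_le.1 le_rfl
  | succ m ih =>
    rw [pow_succ']
    exact Submodule.mul_mem_mul (a_mem_charRad ad h) (ih _)

/-- The arrow at an end vertex is by itself a path C(i,w). The commutativity relation identifies it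
with C(i,v) at the other vertex of i, a product of p+q+2 ≥ 2 arrows. -/
theorem a_mem_charRad_sq (ad : Admissible k s) {h : Inc p q k} (hh : ¬ h.IsCentral) :
    LamData.gen.a h ∈ charRad K (LamRing K p q k s θ) ^ 2 := by
  have key (h h' : Inc p q k) (h1 : h.valency = 1) (h2 : h'.valency = p + q + 2)
      (he : h.edge = h'.edge) (hn : h.edge ≠ .cyc 1) :
      LamData.gen.a h ∈ charRad K (LamRing K p q k s θ) ^ 2 := by
    have := LamData.gen.comm (K := K) (θ := θ) (s := s) h h' he (by rintro rfl; omega) hn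
    rw [h1, h2, pathProd, pathProd, mul_one] at this
    rw [this]
    exact charRad_pow_antitone (by omega) (by omega) (pathProd_mem_charRad_pow ad _ _)
  rcases h with ⟨i, j⟩ | ⟨i, j⟩ | ⟨i, l⟩ | ⟨i, r⟩
  · exact absurd rfl hh
  · exact absurd rfl hh
  · exact key _ (.inn i l.succ) rfl rfl rfl (by simp [Inc.edge])
  · exact key _ (.out i r.succ) rfl rfl rfl (by simp [Inc.edge])

/-! ### The grading -/

/-- The homogeneous elements of the polynomial ring which satisfy the relations. -/
noncomputable def LamData.monomialData {A : Type*} [Ring A] [Algebra K A]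
    (D : LamData K p q k s θ A) : LamData K p q k s θ A[X] where
  e v := monomial 0 (D.e v)
  a h := monomial h.degree (D.a h)
  idem v := by rw [monomial_mul_monomial, D.idem]
  orth v w h := by rw [monomial_mul_monomial, D.orth v w h, map_zero]
  one := by rw [← map_sum, D.one]; rfl
  source h := by rw [monomial_mul_monomial, D.source, zero_add]
  target h := by rw [monomial_mul_monomial, D.target, add_zero]
  zero h h' hc hn := by rw [monomial_mul_monomial, D.zero h h' hc hn, map_zero]
  comm h h' he hn h1 := by
    rw [pathProd_monomial, pathProd_monomial, Inc.valency_mul_degree, Inc.valency_mul_degree,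
      D.comm h h' he hn h1]
  comm_one := by
    rw [pathProd_monomial, pathProd_monomial, D.comm_one, smul_monomial]
    rfl

/-- The homomorphism to the polynomial ring which is given by the grading. -/
noncomputable def LamData.grading {A : Type*} [Ring A] [Algebra K A]
    (D : LamData K p q k s θ A) : LamRing K p q k s θ →ₐ[K] A[X] := D.monomialData.lift

theorem grading_coeff_zero (x : LamRing K p q k s θ) :
    (LamData.gen.grading x).coeff 0 = ∑ v, edgeChar s θ v x • LamData.gen.e v := by
  induction x using LamData.gen_induction with
  | algebraMap r =>
    rw [AlgHom.commutes, Polynomial.algebraMap_apply, coeff_C_zero]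
    simp only [AlgHom.commutes, Algebra.algebraMap_self, RingHom.id_apply]
    rw [← Finset.smul_sum, LamData.gen.one, Algebra.algebraMap_eq_smul_one]
  | e v =>
    rw [LamData.grading, LamData.lift_e]
    simp [LamData.monomialData, edgeChar_e]
  | a h =>
    rw [LamData.grading, LamData.lift_a]
    have : h.degree ≠ 0 := by rw [Inc.degree]; split_ifs <;> omega
    simp [LamData.monomialData, edgeChar_a, coeff_monomial, this]
  | add x y hx hy => simp only [map_add, coeff_add, hx, hy, add_smul, Finset.sum_add_distrib]
  | mul x y hx hy =>
    rw [map_mul, mul_coeff_zero, hx, hy, Finset.sum_mul]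
    refine Finset.sum_congr rfl fun v _ => ?_
    rw [Finset.mul_sum, Finset.sum_eq_single v]
    · rw [smul_mul_smul_comm, LamData.gen.idem, map_mul]
    · intro w _ hw
      rw [smul_mul_smul_comm, LamData.gen.orth v w hw.symm, smul_zero]
    · simp

/-- By `grading_coeff_zero` an element of J has zero constant coefficient, so a product of n such
elements starts in degree n at the earliest. -/
theorem grading_coeff_of_mem (ad : Admissible k s) (n : ℕ) {x : LamRing K p q k s θ}
    (hx : x ∈ charRad K (LamRing K p q k s θ) ^ n) (m : ℕ) (hm : m < n) :
    (LamData.gen.grading x).coeff m = 0 := by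
  induction n generalizing x m with
  | zero => omega
  | succ n ih =>
    rw [pow_succ'] at hx
    induction hx using Submodule.mul_induction_on' with
    | mem_mul_mem a ha b hb =>
      rw [map_mul, coeff_mul]
      refine Finset.sum_eq_zero fun ij hij => ?_
      rcases Nat.eq_zero_or_pos ij.1 with h0 | h0
      · rw [h0, grading_coeff_zero, Finset.sum_eq_zero, zero_mul]
        intro v _
        rw [(mem_charRad_iff ad).1 ha, zero_smul]
      · rw [ih hb, mul_zero]
        have := Finset.HasAntidiagonal.mem_antidiagonal.1 hij
        omega
    | add a _ b _ ha hb => rw [map_add, coeff_add, ha, hb, add_zero]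

/-- The path is homogeneous of degree m, and it is nonzero because it extends to some C(i,v). -/
theorem pathProd_notMem_charRad_pow (ad : Admissible k s) (hθ : θ ≠ 0) {h : Inc p q k}
    (hh : h.IsCentral) {m : ℕ} (hm : m ≤ p + q + 2) :
    pathProd s LamData.gen.a m h ∉ charRad K (LamRing K p q k s θ) ^ (m + 1) := by
  intro hmem
  have h1 := grading_coeff_of_mem ad _ hmem m (by omega)
  have h2 : LamData.gen.grading (pathProd s (LamData.gen (K := K) (s := s) (θ := θ)).a m h) =
      monomial m (pathProd s LamData.gen.a m h) := by
    rw [LamData.grading, map_pathProd]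
    simp only [LamData.lift_a]
    refine (pathProd_monomial _ _ _).trans ?_
    rw [Inc.degree, if_pos hh, mul_one]
  rw [h2, coeff_monomial, if_pos rfl] at h1
  refine pathProd_gen_valency_ne_zero (K := K) (s := s) (θ := θ) ad.two_le hθ h ?_
  rw [hh, ← Nat.add_sub_cancel' hm, pathProd_add, h1, zero_mul]

end Characters

end BrauerT

namespace BrauerT

/-! ### Arrows between two given vertices modulo J². -/

section Peirce

variable {p q k s : ℕ}

@[simp]
theorem Inc.edge_inn_zero (i : ZMod k) : (.inn i 0 : Inc p q k).edge = .cyc i := rfl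

@[simp]
theorem Inc.edge_inn_succ (i : ZMod k) (l : Fin q) :
    (.inn i l.succ : Inc p q k).edge = .inner i l := rfl

@[simp]
theorem Inc.edge_out_zero (i : ZMod k) : (.out i 0 : Inc p q k).edge = .cyc (i - 1) := rfl

@[simp]
theorem Inc.edge_out_succ (i : ZMod k) (r : Fin p) :
    (.out i r.succ : Inc p q k).edge = .outer i r := rfl

theorem Inc.IsCentral.eq_or {h : Inc p q k} (hh : h.IsCentral) :
    (∃ i, h = .inn i 0) ∨ (∃ i l, h = .inn i (Fin.succ l)) ∨ (∃ i, h = .out i 0) ∨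
      ∃ i r, h = .out i (Fin.succ r) := by
  rcases h with ⟨i, j⟩ | ⟨i, j⟩ | ⟨i, l⟩ | ⟨i, r⟩
  · rcases Fin.eq_zero_or_eq_succ j with rfl | ⟨l, rfl⟩
    · exact .inl ⟨i, rfl⟩
    · exact .inr (.inl ⟨i, l, rfl⟩)
  · rcases Fin.eq_zero_or_eq_succ j with rfl | ⟨r, rfl⟩
    · exact .inr (.inr (.inl ⟨i, rfl⟩))
    · exact .inr (.inr (.inr ⟨i, r, rfl⟩))
  · simp only [IsCentral, valency] at hh; omega
  · simp only [IsCentral, valency] at hh; omega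

/-- Only the cycle edges have two central incidences. -/
theorem Inc.eq_or_of_edge_eq {g h : Inc p q k} (hg : g.IsCentral) (hh : h.IsCentral)
    (e : g.edge = h.edge) : g = h ∨ (∃ i, g = .inn i 0 ∧ h = .out (i + 1) 0) ∨
      ∃ i, h = .inn i 0 ∧ g = .out (i + 1) 0 := by
  rcases hg.eq_or with ⟨i, rfl⟩ | ⟨i, l, rfl⟩ | ⟨i, rfl⟩ | ⟨i, l, rfl⟩ <;>
    rcases hh.eq_or with ⟨i', rfl⟩ | ⟨i', l', rfl⟩ | ⟨i', rfl⟩ | ⟨i', l', rfl⟩ <;>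
    simp_all
  subst e; ring

theorem Inc.edge_next_inn_zero (hk : 2 ≤ k) (i : ZMod k) :
    ((.inn i 0 : Inc p q k).next s).edge =
      if h : 0 < q then .inner i ⟨0, h⟩ else .cyc (i - 1) := by
  split_ifs with h
  · exact congrArg edge (next_inn_lt s i 0 h)
  · obtain rfl : q = 0 := by omega
    exact congrArg edge (next_inn_last hk s i)

theorem Inc.edge_next_out_zero (i : ZMod k) :
    ((.out i 0 : Inc p q k).next s).edge =
      if h : 0 < p then .outer i ⟨0, h⟩ else .cyc (i + s) := by
  split_ifs with h
  · exact congrArg edge (next_out_lt s i 0 h)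
  · obtain rfl : p = 0 := by omega
    exact congrArg edge (next_out_last s i)

/-- The two central arrows starting at e_i could share a target only if p = q = 0 and i - 1 = i + 1
+ s, that is, s + 2 = 0 in ℤ/k. -/
theorem Inc.eq_of_parallel (ad : Admissible k s) {g h : Inc p q k} (hg : g.IsCentral)
    (hh : h.IsCentral) (e : g.edge = h.edge) (e' : (g.next s).edge = (h.next s).edge) :
    g = h := by
  have : Fact (1 < k) := ⟨ad.two_le⟩
  have key (i : ZMod k) : ((.inn i 0 : Inc p q k).next s).edge ≠
      ((.out (i + 1) 0 : Inc p q k).next s).edge := by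
    rw [edge_next_inn_zero ad.two_le, edge_next_out_zero]
    split_ifs <;> simp only [ne_eq, reduceCtorEq, not_false_eq_true, Edge.cyc.injEq]
    intro h
    refine ad.isUnit_add_two.ne_zero ?_
    linear_combination -h
  rcases eq_or_of_edge_eq hg hh e with h1 | ⟨i, rfl, rfl⟩ | ⟨i, rfl, rfl⟩
  · exact h1
  · exact absurd e' (key i)
  · exact absurd e'.symm (key i)

variable {K : Type*} [Field K] [NeZero k] {θ : K}

/-- The right-hand side contains all generators and is closed under multiplication. -/
theorem mem_span_sup (ad : Admissible k s) (x : LamRing K p q k s θ) :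
    x ∈ Submodule.span K (Set.range LamData.gen.e ∪ LamData.gen.a '' {h | h.IsCentral}) ⊔
      charRad K (LamRing K p q k s θ) ^ 2 := by
  set G : Set (LamRing K p q k s θ) :=
    Set.range LamData.gen.e ∪ LamData.gen.a '' {h | h.IsCentral} with hG
  set J := charRad K (LamRing K p q k s θ)
  have he (v : Edge p q k) : LamData.gen.e v ∈ Submodule.span K G ⊔ J ^ 2 :=
    Submodule.mem_sup_left (Submodule.subset_span (.inl ⟨v, rfl⟩))
  have ha (h : Inc p q k) : LamData.gen.a h ∈ Submodule.span K G ⊔ J ^ 2 := by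
    by_cases hh : h.IsCentral
    · exact Submodule.mem_sup_left (Submodule.subset_span (.inr ⟨h, hh, rfl⟩))
    · exact Submodule.mem_sup_right (a_mem_charRad_sq ad hh)
  have hmul : (Submodule.span K G ⊔ J ^ 2) * (Submodule.span K G ⊔ J ^ 2) ≤
      Submodule.span K G ⊔ J ^ 2 := by
    rw [Submodule.mul_sup]
    refine sup_le ?_ (Submodule.mul_le.2 fun a _ b hb =>
      Submodule.mem_sup_right (mul_mem_charRad_pow_left a hb))
    rw [Submodule.sup_mul]
    refine sup_le ?_ (Submodule.mul_le.2 fun a ha b _ =>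
      Submodule.mem_sup_right (mul_mem_charRad_pow_right b ha))
    rw [Submodule.span_mul_span, Submodule.span_le]
    rintro _ ⟨_, (⟨v, rfl⟩ | ⟨h, -, rfl⟩), _, (⟨w, rfl⟩ | ⟨g, -, rfl⟩), rfl⟩
    · by_cases hvw : v = w
      · subst hvw; simp only [LamData.gen.idem]; exact he v
      · simp only [LamData.gen.orth v w hvw]; exact zero_mem _
    · by_cases hv : v = g.edge
      · subst hv; simp only [LamData.gen.source]; exact ha g
      · simp only
        rw [← LamData.gen.source g, ← mul_assoc, LamData.gen.orth v _ hv, zero_mul]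
        exact zero_mem _
    · by_cases hv : (h.next s).edge = w
      · subst hv; simp only [LamData.gen.target]; exact ha h
      · simp only
        rw [← LamData.gen.target h, mul_assoc, LamData.gen.orth _ w hv, mul_zero]
        exact zero_mem _
    · refine Submodule.mem_sup_right ?_
      simp only
      rw [pow_two]
      exact Submodule.mul_mem_mul (a_mem_charRad ad h) (a_mem_charRad ad g)
  induction x using LamData.gen_induction with
  | algebraMap r =>
    rw [Algebra.algebraMap_eq_smul_one, ← LamData.gen.one]
    exact Submodule.smul_mem _ _ (Submodule.sum_mem _ fun v _ => he v)
  | e v => exact he v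
  | a h => exact ha h
  | add x y hx hy => exact add_mem hx hy
  | mul x y hx hy => exact hmul (Submodule.mul_mem_mul hx hy)

/-- Modulo the square of the radical, `e_i J e_j` is spanned by the arrows from `i` to `j`. -/
theorem e_mul_mul_e_mem (ad : Admissible k s) (i j : Edge p q k) {x : LamRing K p q k s θ}
    (hx : x ∈ charRad K (LamRing K p q k s θ)) :
    LamData.gen.e i * x * LamData.gen.e j ∈
      Submodule.span K (LamData.gen.a '' {h | h.IsCentral ∧ h.edge = i ∧ (h.next s).edge = j}) ⊔
        charRad K (LamRing K p q k s θ) ^ 2 := by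
  set M := Submodule.span K ((LamData.gen (K := K) (θ := θ)).a ''
    {h : Inc p q k | h.IsCentral ∧ h.edge = i ∧ (h.next s).edge = j}) with hM
  set J := charRad K (LamRing K p q k s θ)
  have hMJ : M ≤ J := by
    rw [hM, Submodule.span_le]
    rintro _ ⟨h, -, rfl⟩
    exact a_mem_charRad ad h
  have hJ2 : J ^ 2 ≤ J := fun y hy => by
    simpa using charRad_pow_antitone one_le_two le_rfl hy
  have key : LamData.gen.e i * x * LamData.gen.e j ∈
      Submodule.span K {LamData.gen.e i * LamData.gen.e j} ⊔ (M ⊔ J ^ 2) := by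
    let T : LamRing K p q k s θ →ₗ[K] LamRing K p q k s θ :=
      (LinearMap.mulRight K (LamData.gen.e j)).comp (LinearMap.mulLeft K (LamData.gen.e i))
    have hT (y) : T y = LamData.gen.e i * y * LamData.gen.e j := rfl
    rw [← hT]
    refine Submodule.mem_comap.1 ((sup_le ?_ ?_ : _ ≤ Submodule.comap T _) (mem_span_sup ad x))
    · rw [Submodule.span_le]
      rintro _ (⟨v, rfl⟩ | ⟨h, hh, rfl⟩)
      · refine Submodule.mem_sup_left (Submodule.mem_span_singleton.2 ?_)
        by_cases hv : i = v
        · exact ⟨1, by rw [hT, ← hv, LamData.gen.idem, one_smul]⟩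
        · exact ⟨0, by rw [hT, LamData.gen.orth i v hv, zero_mul, zero_smul]⟩
      · refine Submodule.mem_sup_right (Submodule.mem_sup_left ?_)
        rw [hT]
        by_cases h1 : i = h.edge
        · by_cases h2 : (h.next s).edge = j
          · rw [h1, LamData.gen.source, ← h2, LamData.gen.target]
            exact Submodule.subset_span ⟨h, ⟨hh, h1.symm, h2⟩, rfl⟩
          · rw [← LamData.gen.target h, mul_assoc, mul_assoc, LamData.gen.orth _ j h2]
            simp
        · rw [← LamData.gen.source h, ← mul_assoc, LamData.gen.orth i _ h1]
          simp
    · intro y hy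
      refine Submodule.mem_sup_right (Submodule.mem_sup_right ?_)
      exact mul_mem_charRad_pow_right _ (mul_mem_charRad_pow_left _ hy)
  obtain ⟨y, hy, z, hz, hyz⟩ := Submodule.mem_sup.1 key
  obtain ⟨c, rfl⟩ := Submodule.mem_span_singleton.1 hy
  have hzJ : z ∈ J := (sup_le hMJ hJ2) hz
  rw [← hyz]
  refine add_mem ?_ hz
  -- The remaining term is a multiple of `e i * e j`. For i = j the character at i shows that its
  -- coefficient is 0, since `x` lies in J.
  by_cases hij : i = j
  · subst hij
    have h1 := congrArg (edgeChar s θ i) hyz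
    rw [map_add, (mem_charRad_iff ad).1 hzJ, map_mul, map_mul, (mem_charRad_iff ad).1 hx, map_smul,
      map_mul, edgeChar_e, if_pos rfl] at h1
    have : c = 0 := by simpa using h1
    rw [this, zero_smul]
    exact zero_mem _
  · rw [LamData.gen.orth i j hij, smul_zero]
    exact zero_mem _

theorem exists_sub_smul_mem (ad : Admissible k s) (i j : Edge p q k) {x : LamRing K p q k s θ}
    (hx : x ∈ charRad K (LamRing K p q k s θ))
    (hx2 : LamData.gen.e i * x * LamData.gen.e j ∉ charRad K (LamRing K p q k s θ) ^ 2) :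
    ∃ h : Inc p q k, h.IsCentral ∧ h.edge = i ∧ (h.next s).edge = j ∧ ∃ c : K, c ≠ 0 ∧
      LamData.gen.e i * x * LamData.gen.e j - c • LamData.gen.a h ∈
        charRad K (LamRing K p q k s θ) ^ 2 := by
  obtain ⟨y, hy, z, hz, hyz⟩ := Submodule.mem_sup.1 (e_mul_mul_e_mem ad i j hx)
  by_cases hex : ∃ h : Inc p q k, h.IsCentral ∧ h.edge = i ∧ (h.next s).edge = j
  · obtain ⟨h, h1, h2, h3⟩ := hex
    have hsub : {h : Inc p q k | h.IsCentral ∧ h.edge = i ∧ (h.next s).edge = j} ⊆ {h} :=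
      fun g hg => Inc.eq_of_parallel ad hg.1 h1 (hg.2.1.trans h2.symm) (hg.2.2.trans h3.symm)
    have hy' := Submodule.span_mono (Set.image_mono hsub) hy
    rw [Set.image_singleton] at hy'
    obtain ⟨c, rfl⟩ := Submodule.mem_span_singleton.1 hy'
    refine ⟨h, h1, h2, h3, c, ?_, ?_⟩
    · rintro rfl
      rw [zero_smul, zero_add] at hyz
      exact hx2 (hyz ▸ hz)
    · rw [← hyz, add_sub_cancel_left]
      exact hz
  · have : {h : Inc p q k | h.IsCentral ∧ h.edge = i ∧ (h.next s).edge = j} = ∅ :=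
      Set.eq_empty_of_forall_notMem fun h hh => hex ⟨h, hh⟩
    rw [this, Set.image_empty, Submodule.span_empty, Submodule.mem_bot] at hy
    rw [hy, zero_add] at hyz
    exact absurd (hyz ▸ hz) hx2

end Peirce

/-! ### The action of an isomorphism on vertices and central arrows. -/

section Transport

variable {p q k s p' q' k' s' : ℕ} {K : Type*} [Field K] [NeZero k] [NeZero k'] {θ θ' : K}

/-- The bijection between the vertices of the quivers of isomorphic algebras. -/
noncomputable def edgePerm (ad : Admissible k s) (ad' : Admissible k' s')
    (φ : LamRing K p q k s θ ≃ₐ[K] LamRing K p' q' k' s' θ') : Edge p q k ≃ Edge p' q' k' :=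
  (Equiv.ofBijective _ (edgeChar_bijective ad)).trans
    ((φ.arrowCongr AlgEquiv.refl).trans (Equiv.ofBijective _ (edgeChar_bijective ad')).symm)

theorem edgeChar_edgePerm (ad : Admissible k s) (ad' : Admissible k' s')
    (φ : LamRing K p q k s θ ≃ₐ[K] LamRing K p' q' k' s' θ') (v : Edge p q k)
    (x : LamRing K p' q' k' s' θ') :
    edgeChar s' θ' (edgePerm ad ad' φ v) x = edgeChar s θ v (φ.symm x) := by
  have := (Equiv.ofBijective _ (edgeChar_bijective ad')).apply_symm_apply
    ((φ.arrowCongr AlgEquiv.refl) (edgeChar s θ v))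
  exact AlgHom.congr_fun this x

theorem edgePerm_symm (ad : Admissible k s) (ad' : Admissible k' s')
    (φ : LamRing K p q k s θ ≃ₐ[K] LamRing K p' q' k' s' θ') :
    edgePerm ad' ad φ.symm = (edgePerm ad ad' φ).symm := rfl

theorem map_e_sub_mem (ad : Admissible k s) (ad' : Admissible k' s')
    (φ : LamRing K p q k s θ ≃ₐ[K] LamRing K p' q' k' s' θ') (v : Edge p q k) :
    φ (LamData.gen.e v) - LamData.gen.e (edgePerm ad ad' φ v) ∈
      charRad K (LamRing K p' q' k' s' θ') := by
  classical
  rw [mem_charRad_iff ad']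
  intro w
  obtain ⟨w, rfl⟩ := (edgePerm ad ad' φ).surjective w
  rw [map_sub, edgeChar_e, edgeChar_edgePerm, AlgEquiv.symm_apply_apply, edgeChar_e]
  simp

/-- The image of a trivial path is a trivial path only modulo J, but the error is multiplied by an
element of J and so disappears modulo J². Since central arrows are not in J², the image has a
nonzero component along the unique central arrow with these ends. -/
theorem exists_map_a_sub_mem (ad : Admissible k s) (ad' : Admissible k' s') (hθ : θ ≠ 0)
    (φ : LamRing K p q k s θ ≃ₐ[K] LamRing K p' q' k' s' θ') {h : Inc p q k} (hh : h.IsCentral) :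
    ∃ g : Inc p' q' k', g.IsCentral ∧ g.edge = edgePerm ad ad' φ h.edge ∧
      (g.next s').edge = edgePerm ad ad' φ (h.next s).edge ∧ ∃ c : K, c ≠ 0 ∧
        φ (LamData.gen.a h) - c • LamData.gen.a g ∈ charRad K (LamRing K p' q' k' s' θ') ^ 2 := by
  set J := charRad K (LamRing K p' q' k' s' θ')
  have hJ : φ (LamData.gen.a h) ∈ J := by
    simpa using φ.map_mem_charRad_pow 1 (x := LamData.gen.a h) (by simpa using a_mem_charRad ad h)
  have h2 : φ (LamData.gen.a h) ∉ J ^ 2 := fun hmem => by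
    have h3 := φ.symm.map_mem_charRad_pow 2 hmem
    rw [AlgEquiv.symm_apply_apply] at h3
    refine pathProd_notMem_charRad_pow ad hθ hh (m := 1) (by omega) ?_
    simpa [pathProd] using h3
  set u := φ (LamData.gen.a h)
  set i := edgePerm ad ad' φ h.edge
  set j := edgePerm ad ad' φ (h.next s).edge
  have hi := map_e_sub_mem ad ad' φ h.edge
  have hj := map_e_sub_mem ad ad' φ (h.next s).edge
  have hs1 : φ (LamData.gen.e h.edge) * u = u := by rw [← map_mul, LamData.gen.source]
  have hs2 : u * φ (LamData.gen.e (h.next s).edge) = u := by rw [← map_mul, LamData.gen.target]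
  have hd : u - LamData.gen.e i * u * LamData.gen.e j ∈ J ^ 2 := by
    have e1 : u - LamData.gen.e i * u * LamData.gen.e j =
        (φ (LamData.gen.e h.edge) - LamData.gen.e i) * u +
          LamData.gen.e i * (u * (φ (LamData.gen.e (h.next s).edge) - LamData.gen.e j)) := by
      rw [sub_mul, hs1, mul_sub, hs2, mul_sub, ← mul_assoc]
      abel
    rw [e1]
    refine add_mem ?_ (mul_mem_charRad_pow_left _ ?_)
    · rw [pow_two]; exact Submodule.mul_mem_mul hi hJ
    · change _ ∈ J ^ 2
      rw [pow_two]; exact Submodule.mul_mem_mul hJ hj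
  obtain ⟨g, g1, g2, g3, c, hc, hg⟩ := exists_sub_smul_mem ad' i j hJ fun hmem => h2 <| by
    have := add_mem hd hmem
    rwa [sub_add_cancel] at this
  refine ⟨g, g1, g2, g3, c, hc, ?_⟩
  have := add_mem hd hg
  rwa [sub_add_sub_cancel] at this

end Transport

end BrauerT

/-! ### Combinatorics of isomorphisms between the orders. -/

namespace BrauerT

variable {p q k s p' q' k' s' : ℕ}

theorem iterate_next_inn_zero (hk : 2 ≤ k) (i : ZMod k) :
    (Inc.next s)^[q + 1] (.inn i 0 : Inc p q k) = .out i 0 := by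
  have := iterate_inn (p := p) (q := q) s i q 0 (by omega)
  simp only [Nat.zero_add] at this
  rw [Function.iterate_succ_apply']
  exact (congrArg _ this).trans (next_inn_last hk s i)

theorem iterate_next_out_zero (i : ZMod k) :
    (Inc.next s)^[p + 1] (.out i 0 : Inc p q k) = .inn (i + s) 0 := by
  have := iterate_out (p := p) (q := q) s i p 0 (by omega)
  simp only [Nat.zero_add] at this
  rw [Function.iterate_succ_apply']
  exact (congrArg _ this).trans (next_out_last s i)

/-- An isomorphism between the orders on the incidences at the vertices of the cycles. -/
structure IncIso (p q k s p' q' k' s' : ℕ) where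
  edgeMap : Edge p q k ≃ Edge p' q' k'
  toFun : Inc p q k → Inc p' q' k'
  invFun : Inc p' q' k' → Inc p q k
  isCentral {h : Inc p q k} : h.IsCentral → (toFun h).IsCentral
  isCentral_inv {h : Inc p' q' k'} : h.IsCentral → (invFun h).IsCentral
  edge {h : Inc p q k} : h.IsCentral → (toFun h).edge = edgeMap h.edge
  edge_inv {h : Inc p' q' k'} : h.IsCentral → (invFun h).edge = edgeMap.symm h.edge
  next {h : Inc p q k} : h.IsCentral → toFun (h.next s) = (toFun h).next s'
  next_inv {h : Inc p' q' k'} : h.IsCentral → invFun (h.next s') = (invFun h).next s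
  left_inv {h : Inc p q k} : h.IsCentral → invFun (toFun h) = h
  right_inv {h : Inc p' q' k'} : h.IsCentral → toFun (invFun h) = h

namespace IncIso

/-- The inverse of an isomorphism. -/
def symm (f : IncIso p q k s p' q' k' s') : IncIso p' q' k' s' p q k s where
  edgeMap := f.edgeMap.symm
  toFun := f.invFun
  invFun := f.toFun
  isCentral := f.isCentral_inv
  isCentral_inv := f.isCentral
  edge := f.edge_inv
  edge_inv := f.edge
  next := f.next_inv
  next_inv := f.next
  left_inv := f.right_inv
  right_inv := f.left_inv

variable (f : IncIso p q k s p' q' k' s')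

theorem iterate {h : Inc p q k} (hh : h.IsCentral) (n : ℕ) :
    f.toFun ((Inc.next s)^[n] h) = (Inc.next s')^[n] (f.toFun h) := by
  induction n generalizing h with
  | zero => rfl
  | succ n ih => rw [Function.iterate_succ_apply, ih hh.next, f.next hh, Function.iterate_succ_apply]

/-- The two incidences of e_i are distinct central incidences with a common edge, and `f` preserves
this property. -/
theorem eq_pair (i : ZMod k) :
    (∃ i', f.toFun (.inn i 0) = .inn i' 0 ∧ f.toFun (.out (i + 1) 0) = .out (i' + 1) 0) ∨
      ∃ i', f.toFun (.out (i + 1) 0) = .inn i' 0 ∧ f.toFun (.inn i 0) = .out (i' + 1) 0 := by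
  have h1 : (.inn i 0 : Inc p q k).IsCentral := rfl
  have h2 : (.out (i + 1) 0 : Inc p q k).IsCentral := rfl
  rcases Inc.eq_or_of_edge_eq (f.isCentral h1) (f.isCentral h2)
    (by rw [f.edge h1, f.edge h2]; simp) with h | h | h
  · have := congrArg f.invFun h
    rw [f.left_inv h1, f.left_inv h2] at this
    simp at this
  · exact .inl h
  · exact .inr h

theorem exists_eq_zero (h : Inc p q k) (hh : (∃ i, h = .inn i 0) ∨ ∃ i, h = .out i 0) :
    (∃ i, f.toFun h = .inn i 0) ∨ ∃ i, f.toFun h = .out i 0 := by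
  rcases hh with ⟨i, rfl⟩ | ⟨i, rfl⟩
  · rcases f.eq_pair i with ⟨j, h, -⟩ | ⟨j, -, h⟩
    · exact .inl ⟨_, h⟩
    · exact .inr ⟨_, h⟩
  · have := f.eq_pair (i - 1)
    rw [sub_add_cancel] at this
    rcases this with ⟨j, -, h⟩ | ⟨j, h, -⟩
    · exact .inr ⟨_, h⟩
    · exact .inl ⟨_, h⟩

theorem iterate_inn_ne {n : ℕ} (hn : n < q) (i : ZMod k) (h : Inc p q k)
    (hh : (∃ i, h = .inn i 0) ∨ ∃ i, h = .out i 0) :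
    (Inc.next s)^[n + 1] (.inn i 0 : Inc p q k) ≠ h := by
  have := iterate_inn (p := p) (q := q) s i (n + 1) 0 (by omega)
  intro e
  rcases hh with ⟨j, rfl⟩ | ⟨j, rfl⟩ <;> simpa [Fin.ext_iff] using this.symm.trans e

theorem iterate_out_ne {n : ℕ} (hn : n < p) (i : ZMod k) (h : Inc p q k)
    (hh : (∃ i, h = .inn i 0) ∨ ∃ i, h = .out i 0) :
    (Inc.next s)^[n + 1] (.out i 0 : Inc p q k) ≠ h := by
  have := iterate_out (p := p) (q := q) s i (n + 1) 0 (by omega)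
  intro e
  rcases hh with ⟨j, rfl⟩ | ⟨j, rfl⟩ <;> simpa [Fin.ext_iff] using this.symm.trans e

/-- After q+1 steps from `inn i 0` a cycle edge is reached again, and `f` preserves incidences of
cycle edges. If q < q', then q+1 steps from `inn j 0` would still end at an inner edge. Applying
such bounds to `f` and `f.symm` gives equalities. -/
theorem le_of_inn_inn (hk : 2 ≤ k) {i : ZMod k} {j : ZMod k'}
    (h : f.toFun (.inn i 0) = .inn j 0) : q' ≤ q := by
  by_contra! hlt
  refine iterate_inn_ne (s := s') hlt j _ (f.exists_eq_zero _ (.inr ⟨i, rfl⟩)) ?_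
  rw [← iterate_next_inn_zero (s := s) hk, f.iterate (h := .inn i 0) rfl, h]

theorem le_of_inn_out (hk : 2 ≤ k) {i : ZMod k} {j : ZMod k'}
    (h : f.toFun (.inn i 0) = .out j 0) : p' ≤ q := by
  by_contra! hlt
  refine iterate_out_ne (s := s') hlt j _ (f.exists_eq_zero _ (.inr ⟨i, rfl⟩)) ?_
  rw [← iterate_next_inn_zero (s := s) hk, f.iterate (h := .inn i 0) rfl, h]

theorem le_of_out_inn {i : ZMod k} {j : ZMod k'}
    (h : f.toFun (.out i 0) = .inn j 0) : q' ≤ p := by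
  by_contra! hlt
  refine iterate_inn_ne (s := s') hlt j _ (f.exists_eq_zero _ (.inl ⟨i + s, rfl⟩)) ?_
  rw [← iterate_next_out_zero (s := s), f.iterate (h := .out i 0) rfl, h]

theorem card_edge [NeZero k] : Fintype.card (Edge p q k) = k * (p + q + 1) := by
  rw [Fintype.card_congr edgeEquiv]
  simp only [Fintype.card_sum, Fintype.card_prod, ZMod.card, Fintype.card_fin]
  ring

/-- The incidences at the vertices of the cycle. -/
def centralEquiv :
    {h : Inc p q k // h.IsCentral} ≃ (ZMod k × Fin (q + 1)) ⊕ (ZMod k × Fin (p + 1)) where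
  toFun
    | ⟨.inn i j, _⟩ => .inl (i, j)
    | ⟨.out i j, _⟩ => .inr (i, j)
    | ⟨.innEnd i _, _⟩ => .inl (i, 0)
    | ⟨.outEnd i _, _⟩ => .inl (i, 0)
  invFun
    | .inl (i, j) => ⟨.inn i j, rfl⟩
    | .inr (i, j) => ⟨.out i j, rfl⟩
  left_inv := by
    rintro ⟨i | i | i | i, h⟩
    · rfl
    · rfl
    · simp only [Inc.IsCentral, Inc.valency] at h; omega
    · simp only [Inc.IsCentral, Inc.valency] at h; omega
  right_inv := by rintro (⟨i, j⟩ | ⟨i, j⟩) <;> rfl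

/-- There are k(p+q+1) edges and k(p+q+2) central incidences; the difference is k. -/
theorem card_eq [NeZero k] [NeZero k'] (f : IncIso p q k s p' q' k' s') :
    k = k' ∧ p + q = p' + q' := by
  have h1 : k * (p + q + 1) = k' * (p' + q' + 1) := by
    rw [← card_edge, ← card_edge, Fintype.card_congr f.edgeMap]
  let e : {h : Inc p q k // h.IsCentral} ≃ {h : Inc p' q' k' // h.IsCentral} :=
    { toFun := fun h => ⟨f.toFun h, f.isCentral h.2⟩
      invFun := fun h => ⟨f.invFun h, f.isCentral_inv h.2⟩
      left_inv := fun h => Subtype.ext (f.left_inv h.2)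
      right_inv := fun h => Subtype.ext (f.right_inv h.2) }
  have h2 := Fintype.card_congr ((centralEquiv.symm.trans e).trans centralEquiv)
  simp only [Fintype.card_sum, Fintype.card_prod, ZMod.card, Fintype.card_fin] at h2
  have h3 : k = k' := by linarith
  subst h3
  have := Nat.eq_of_mul_eq_mul_left (NeZero.pos k) h1
  exact ⟨rfl, by omega⟩

/-- At central incidences rotation is the (p+q+2)-nd iterate of `next`. -/
theorem map_rot (hk : 2 ≤ k) (hk' : 2 ≤ k') (hpq : p + q = p' + q') {h : Inc p q k}
    (hh : h.IsCentral) : f.toFun (h.rot s) = (f.toFun h).rot s' := by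
  rw [← next_iterate_valency hk, ← next_iterate_valency hk', f.iterate hh, f.isCentral hh, hh, hpq]

theorem map_iterate_rot (hk : 2 ≤ k) (hk' : 2 ≤ k') (hpq : p + q = p' + q') {h : Inc p q k}
    (hh : h.IsCentral) (n : ℕ) :
    f.toFun ((Inc.rot s)^[n] h) = (Inc.rot s')^[n] (f.toFun h) := by
  induction n generalizing h with
  | zero => rfl
  | succ n ih =>
    rw [Function.iterate_succ_apply, ih (h.valency_rot.trans hh), f.map_rot hk hk' hpq hh,
      Function.iterate_succ_apply]

theorem iterate_rot_inn (n : ℕ) (i : ZMod k) (j : Fin (q + 1)) :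
    (Inc.rot s)^[n] (.inn i j : Inc p q k) = .inn (i + n * s) j := by
  induction n generalizing i with
  | zero => simp
  | succ n ih =>
    rw [Function.iterate_succ_apply, Inc.rot, ih]
    push_cast; congr 1; ring

theorem iterate_rot_out (n : ℕ) (i : ZMod k) (j : Fin (p + 1)) :
    (Inc.rot s)^[n] (.out i j : Inc p q k) = .out (i + n * s) j := by
  induction n generalizing i with
  | zero => simp
  | succ n ih =>
    rw [Function.iterate_succ_apply, Inc.rot, ih]
    push_cast; congr 1; ring

/-- Compatibility with rotations makes `f` affine on the index with slope s'/s. The pairing of the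
two incidences of e_0 then forces the slope to be 1. -/
theorem map_inn_of_inn [NeZero k] (ad : Admissible k s) (f : IncIso p q k s p q k s') {c : ZMod k}
    (h : f.toFun (.inn 0 0) = .inn c 0) :
    (s : ZMod k) = s' ∧ ∀ i, f.toFun (.inn i 0) = .inn (c + i) 0 := by
  obtain ⟨t, ht⟩ := ad.isUnit.exists_right_inv
  have h1 (i : ZMod k) : f.toFun (.inn i 0) = .inn (c + i * t * s') 0 := by
    -- As `t` is inverse to s, rotating `i * t` times moves index 0 to index i.
    have := f.map_iterate_rot ad.two_le ad.two_le rfl (h := .inn 0 0) rfl (i * t).val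
    rw [iterate_rot_inn, h, iterate_rot_inn, ZMod.natCast_zmod_val, zero_add, mul_assoc,
      mul_comm t, ht, mul_one] at this
    exact this
  have h2 : f.toFun (.out 1 0) = .out (c + t * s') 0 := by
    rw [← iterate_next_inn_zero (s := s) ad.two_le, f.iterate (h := .inn 1 0) rfl, h1,
      iterate_next_inn_zero ad.two_le, one_mul]
  have h3 : t * s' = 1 := by
    rcases f.eq_pair 0 with ⟨j, h4, h5⟩ | ⟨j, -, h4⟩
    · rw [h, Inc.inn.injEq] at h4
      rw [zero_add, h2, ← h4.1, Inc.out.injEq] at h5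
      exact add_left_cancel h5.1
    · rw [h] at h4; cases h4
  refine ⟨?_, fun i => ?_⟩
  · linear_combination (-s : ZMod k) * h3 + s' * ht
  · rw [h1, mul_assoc, h3, mul_one]

/-- Again `f` is affine with slope s'/s. Now the partner of `out c 0` is `inn (c - 1) 0`, which
gives s'/s + s' = -1, equivalently (s+1)(s'+1) = 1. -/
theorem map_inn_of_out [NeZero k] (ad : Admissible k s) (ad' : Admissible k s')
    (f : IncIso p q k s q p k s') {c : ZMod k} (h : f.toFun (.inn 0 0) = .out c 0) :
    ((s : ZMod k) + 1) * (s' + 1) = 1 ∧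
      ∃ w : ZMod k, IsUnit w ∧ ∀ i, f.toFun (.inn i 0) = .out (c + i * w) 0 := by
  obtain ⟨t, ht⟩ := ad.isUnit.exists_right_inv
  have h1 (i : ZMod k) : f.toFun (.inn i 0) = .out (c + i * (t * s')) 0 := by
    have := f.map_iterate_rot ad.two_le ad.two_le (add_comm p q) (h := .inn 0 0) rfl (i * t).val
    rw [iterate_rot_inn, h, iterate_rot_out, ZMod.natCast_zmod_val, zero_add, mul_assoc,
      mul_comm t, ht, mul_one, mul_assoc] at this
    exact this
  have h2 : f.toFun (.out 1 0) = .inn (c + t * s' + s') 0 := by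
    rw [← iterate_next_inn_zero (s := s) ad.two_le, f.iterate (h := .inn 1 0) rfl, h1,
      iterate_next_out_zero, one_mul]
  refine ⟨?_, t * s', IsUnit.mul (.of_mul_eq_one _ ((mul_comm _ _).trans ht)) ad'.isUnit, h1⟩
  rcases f.eq_pair 0 with ⟨j, h4, -⟩ | ⟨j, h4, h5⟩
  · rw [h] at h4; cases h4
  · rw [h, Inc.out.injEq] at h5
    rw [zero_add, h2, Inc.inn.injEq, h5.1] at h4
    linear_combination (s : ZMod k) * h4.1 - s' * ht

end IncIso

end BrauerT

/-- Leading terms multiply: the difference is (x - y)x' + y(x' - y'). -/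
theorem mul_sub_mul_mem_charRad_pow {K A : Type*} [Field K] [Ring A] [Algebra K A] {m n : ℕ}
    {x x' y y' : A} (h1 : x - y ∈ charRad K A ^ (m + 1)) (h2 : y ∈ charRad K A ^ m)
    (h3 : x' ∈ charRad K A ^ n) (h4 : x' - y' ∈ charRad K A ^ (n + 1)) :
    x * x' - y * y' ∈ charRad K A ^ (m + n + 1) := by
  have e : x * x' - y * y' = (x - y) * x' + y * (x' - y') := by noncomm_ring
  rw [e]
  refine add_mem ?_ ?_
  · rw [add_right_comm, pow_add]; exact Submodule.mul_mem_mul h1 h3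
  · rw [add_assoc, pow_add]; exact Submodule.mul_mem_mul h2 h4

/-! ### Leading coefficients of an isomorphism and the parameters. -/

namespace BrauerT

variable {p q k s p' q' k' s' : ℕ} {K : Type*} [Field K] [NeZero k] [NeZero k'] {θ θ' : K}

theorem exists_incIso (ad : Admissible k s) (ad' : Admissible k' s') (hθ : θ ≠ 0) (hθ' : θ' ≠ 0)
    (φ : LamRing K p q k s θ ≃ₐ[K] LamRing K p' q' k' s' θ') :
    ∃ (f : IncIso p q k s p' q' k' s') (c : Inc p q k → K), ∀ h, h.IsCentral → c h ≠ 0 ∧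
      φ (LamData.gen.a h) - c h • LamData.gen.a (f.toFun h) ∈
        charRad K (LamRing K p' q' k' s' θ') ^ 2 := by
  have key {p q k s p' q' k' s' : ℕ} [NeZero k] [NeZero k'] {θ θ' : K} (ad : Admissible k s)
      (ad' : Admissible k' s') (hθ : θ ≠ 0)
      (φ : LamRing K p q k s θ ≃ₐ[K] LamRing K p' q' k' s' θ') :
      ∃ (F : Inc p q k → Inc p' q' k') (c : Inc p q k → K), ∀ h, h.IsCentral →
        (F h).IsCentral ∧ (F h).edge = edgePerm ad ad' φ h.edge ∧ F (h.next s) = (F h).next s' ∧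
        ((F h).next s').edge = edgePerm ad ad' φ (h.next s).edge ∧ c h ≠ 0 ∧
        φ (LamData.gen.a h) - c h • LamData.gen.a (F h) ∈
          charRad K (LamRing K p' q' k' s' θ') ^ 2 := by
    have h1 (h : Inc p q k) : ∃ (g : Inc p' q' k') (c : K), h.IsCentral →
        g.IsCentral ∧ g.edge = edgePerm ad ad' φ h.edge ∧
        (g.next s').edge = edgePerm ad ad' φ (h.next s).edge ∧ c ≠ 0 ∧
        φ (LamData.gen.a h) - c • LamData.gen.a g ∈ charRad K (LamRing K p' q' k' s' θ') ^ 2 := by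
      by_cases hh : h.IsCentral
      · obtain ⟨g, g1, g2, g3, c, hc, g4⟩ := exists_map_a_sub_mem ad ad' hθ φ hh
        exact ⟨g, c, fun _ => ⟨g1, g2, g3, hc, g4⟩⟩
      -- Arbitrary values: nothing is claimed off the central incidences.
      · exact ⟨.inn 0 0, 0, fun h => absurd h hh⟩
    choose F c hF using h1
    refine ⟨F, c, fun h hh => ?_⟩
    obtain ⟨g1, g2, g3, hc, g4⟩ := hF h hh
    obtain ⟨g1', g2', g3', hc', g4'⟩ := hF _ (hh.next (s := s))
    refine ⟨g1, g2, ?_, g3, hc, g4⟩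
    -- If the images were not consecutive, their product would vanish, and the product of the two
    -- consecutive arrows would lie in J³.
    by_contra hne
    have hJ : φ (LamData.gen.a (h.next s)) ∈ charRad K (LamRing K p' q' k' s' θ') ^ 1 :=
      φ.map_mem_charRad_pow 1 (by simpa using a_mem_charRad ad _)
    have hJ' : c h • LamData.gen.a (F h) ∈ charRad K (LamRing K p' q' k' s' θ') ^ 1 :=
      Submodule.smul_mem _ _ (by simpa using a_mem_charRad ad' _)
    have h2 := mul_sub_mul_mem_charRad_pow g4 hJ' hJ g4'
    rw [smul_mul_smul_comm, LamData.gen.mul_eq_zero_of_next_ne (Ne.symm hne), smul_zero, sub_zero,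
      ← map_mul] at h2
    have h3 := φ.symm.map_mem_charRad_pow _ h2
    rw [AlgEquiv.symm_apply_apply] at h3
    refine pathProd_notMem_charRad_pow ad hθ hh (m := 2) (by omega) ?_
    simpa [pathProd] using h3
  obtain ⟨F, c, hF⟩ := key ad ad' hθ φ
  obtain ⟨G, d, hG⟩ := key ad' ad hθ' φ.symm
  rw [edgePerm_symm ad ad'] at hG
  refine ⟨⟨edgePerm ad ad' φ, F, G, fun {h} hh => (hF h hh).1, fun {h} hh => (hG h hh).1,
    fun {h} hh => (hF h hh).2.1, fun {h} hh => (hG h hh).2.1, fun {h} hh => (hF h hh).2.2.1,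
    fun {h} hh => (hG h hh).2.2.1, fun {h} hh => ?_, fun {h} hh => ?_⟩, c,
    fun h hh => (hF h hh).2.2.2.2⟩
  -- The arrow of `G (F h)` is parallel to that of `h`, hence both coincide.
  · obtain ⟨f1, f2, f3, f4, -⟩ := hF h hh
    obtain ⟨g1, g2, g3, g4, -⟩ := hG _ f1
    refine Inc.eq_of_parallel ad g1 hh ?_ ?_
    · rw [g2, f2, Equiv.symm_apply_apply]
    · rw [g4, f4, Equiv.symm_apply_apply]
  · obtain ⟨f1, f2, f3, f4, -⟩ := hG h hh
    obtain ⟨g1, g2, g3, g4, -⟩ := hF _ f1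
    refine Inc.eq_of_parallel ad' g1 hh ?_ ?_
    · rw [g2, f2, Equiv.apply_symm_apply]
    · rw [g4, f4, Equiv.apply_symm_apply]

theorem map_pathProd_sub_mem (ad : Admissible k s) (ad' : Admissible k' s')
    (φ : LamRing K p q k s θ ≃ₐ[K] LamRing K p' q' k' s' θ') (f : IncIso p q k s p' q' k' s')
    (c : Inc p q k → K)
    (hc : ∀ h, h.IsCentral → φ (LamData.gen.a h) - c h • LamData.gen.a (f.toFun h) ∈
        charRad K (LamRing K p' q' k' s' θ') ^ 2) (m : ℕ) {h : Inc p q k} (hh : h.IsCentral) :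
    φ (pathProd s LamData.gen.a m h) -
        pathProd s c m h • pathProd s' LamData.gen.a m (f.toFun h) ∈
      charRad K (LamRing K p' q' k' s' θ') ^ (m + 1) := by
  induction m generalizing h with
  | zero => simp [pathProd]
  | succ m ih =>
    have h1 := hc h hh
    have h2 := ih (hh.next (s := s))
    rw [f.next hh] at h2
    have hJ : φ (pathProd s LamData.gen.a m (h.next s)) ∈
        charRad K (LamRing K p' q' k' s' θ') ^ m :=
      φ.map_mem_charRad_pow m (pathProd_mem_charRad_pow ad m _)
    have hJ' : c h • LamData.gen.a (f.toFun h) ∈ charRad K (LamRing K p' q' k' s' θ') ^ 1 :=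
      Submodule.smul_mem _ _ (by simpa using a_mem_charRad ad' _)
    have h3 := mul_sub_mul_mem_charRad_pow h1 hJ' hJ h2
    rw [smul_mul_smul_comm, ← map_mul] at h3
    rw [add_comm 1 m] at h3
    exact h3

/-- The scalar in the commutativity relation at `e_i`. -/
def edgeScalar (θ : K) (i : ZMod k) : K := if i = 1 then θ else 1

theorem pathProd_gen_inn (i : ZMod k) :
    pathProd s (LamData.gen (K := K) (p := p) (q := q) (s := s) (θ := θ)).a (p + q + 2)
        (.inn i 0) =
      edgeScalar θ i • pathProd s LamData.gen.a (p + q + 2) (.out (i + 1) 0) := by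
  rw [edgeScalar]
  split_ifs with h
  · subst h; exact LamData.gen.comm_one
  · rw [one_smul]
    exact LamData.gen.comm (.inn i 0) (.out (i + 1) 0) (by simp) (by simp) (by simpa using h)

/-- The image under `φ` of the commutativity relation at e_i, reduced to leading terms. -/
theorem smul_sub_smul_mem (ad : Admissible k s) (ad' : Admissible k' s')
    (φ : LamRing K p q k s θ ≃ₐ[K] LamRing K p' q' k' s' θ') (f : IncIso p q k s p' q' k' s')
    (c : Inc p q k → K)
    (hc : ∀ h, h.IsCentral → φ (LamData.gen.a h) - c h • LamData.gen.a (f.toFun h) ∈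
        charRad K (LamRing K p' q' k' s' θ') ^ 2) (i : ZMod k) :
    pathProd s c (p + q + 2) (.inn i 0) •
        pathProd s' LamData.gen.a (p + q + 2) (f.toFun (.inn i 0)) -
      (edgeScalar θ i * pathProd s c (p + q + 2) (.out (i + 1) 0)) •
        pathProd s' LamData.gen.a (p + q + 2) (f.toFun (.out (i + 1) 0)) ∈
      charRad K (LamRing K p' q' k' s' θ') ^ (p + q + 2 + 1) := by
  have h1 := map_pathProd_sub_mem ad ad' φ f c hc (p + q + 2) (h := .inn i 0) rfl
  have h2 := map_pathProd_sub_mem ad ad' φ f c hc (p + q + 2) (h := .out (i + 1) 0) rfl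
  rw [pathProd_gen_inn, map_smul] at h1
  have h3 := sub_mem (Submodule.smul_mem _ (edgeScalar θ i) h2) h1
  rw [smul_sub, smul_smul, sub_sub_sub_cancel_left] at h3
  exact h3

/-- Both leading terms are multiples of one path C(j,v), which is nonzero modulo the next power of
J, so the coefficients agree. -/
theorem eq_of_inn_inn (ad : Admissible k s) (ad' : Admissible k' s') (hθ' : θ' ≠ 0)
    (hpq : p + q = p' + q')
    (φ : LamRing K p q k s θ ≃ₐ[K] LamRing K p' q' k' s' θ') (f : IncIso p q k s p' q' k' s')
    (c : Inc p q k → K)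
    (hc : ∀ h, h.IsCentral → φ (LamData.gen.a h) - c h • LamData.gen.a (f.toFun h) ∈
        charRad K (LamRing K p' q' k' s' θ') ^ 2) {i : ZMod k} {j : ZMod k'}
    (h1 : f.toFun (.inn i 0) = .inn j 0) (h2 : f.toFun (.out (i + 1) 0) = .out (j + 1) 0) :
    pathProd s c (p + q + 2) (.inn i 0) * edgeScalar θ' j =
      edgeScalar θ i * pathProd s c (p + q + 2) (.out (i + 1) 0) := by
  have h := smul_sub_smul_mem ad ad' φ f c hc i
  rw [h1, h2, hpq, pathProd_gen_inn, smul_smul, ← sub_smul] at h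
  rw [hpq]
  by_contra hne
  refine pathProd_notMem_charRad_pow ad' hθ' (p := p') (q := q') (h := .out (j + 1) 0) rfl
    le_rfl ?_
  exact (Submodule.smul_mem_iff _ (sub_ne_zero.2 hne)).1 h

theorem eq_of_inn_out (ad : Admissible k s) (ad' : Admissible k' s') (hθ' : θ' ≠ 0)
    (hpq : p + q = p' + q')
    (φ : LamRing K p q k s θ ≃ₐ[K] LamRing K p' q' k' s' θ') (f : IncIso p q k s p' q' k' s')
    (c : Inc p q k → K)
    (hc : ∀ h, h.IsCentral → φ (LamData.gen.a h) - c h • LamData.gen.a (f.toFun h) ∈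
        charRad K (LamRing K p' q' k' s' θ') ^ 2) {i : ZMod k} {j : ZMod k'}
    (h1 : f.toFun (.inn i 0) = .out (j + 1) 0) (h2 : f.toFun (.out (i + 1) 0) = .inn j 0) :
    pathProd s c (p + q + 2) (.inn i 0) =
      edgeScalar θ i * pathProd s c (p + q + 2) (.out (i + 1) 0) * edgeScalar θ' j := by
  have h := smul_sub_smul_mem ad ad' φ f c hc i
  rw [h1, h2, hpq, pathProd_gen_inn, smul_smul, ← sub_smul] at h
  rw [hpq]
  by_contra hne
  refine pathProd_notMem_charRad_pow ad' hθ' (p := p') (q := q') (h := .out (j + 1) 0) rfl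
    le_rfl ?_
  exact (Submodule.smul_mem_iff _ (sub_ne_zero.2 hne)).1 h

theorem prod_edgeScalar (θ : K) : ∏ i : ZMod k, edgeScalar θ i = θ := by
  simp [edgeScalar]

/-- Each path splits into an inner segment and an outer segment. Over all i, both sides use every
segment once, up to a shift of the index. -/
theorem prod_pathProd (hk : 2 ≤ k) (c : Inc p q k → K) :
    ∏ i : ZMod k, pathProd s c (p + q + 2) (.inn i 0) =
      ∏ i : ZMod k, pathProd s c (p + q + 2) (.out (i + 1) 0) := by
  have h1 (i : ZMod k) : pathProd s c (p + q + 2) (.inn i 0) =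
      pathProd s c (q + 1) (.inn i 0) * pathProd s c (p + 1) (.out i 0) := by
    rw [show p + q + 2 = (q + 1) + (p + 1) by ring, pathProd_add, iterate_next_inn_zero hk]
  have h2 (i : ZMod k) : pathProd s c (p + q + 2) (.out i 0) =
      pathProd s c (p + 1) (.out i 0) * pathProd s c (q + 1) (.inn (i + s) 0) := by
    rw [show p + q + 2 = (p + 1) + (q + 1) by ring, pathProd_add, iterate_next_out_zero]
  have h3 (x : ZMod k) (g : ZMod k → K) : ∏ i, g (i + x) = ∏ i, g i :=
    (Equiv.addRight x).bijective.prod_comp g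
  rw [h3 1 fun i => pathProd s c (p + q + 2) (.out i 0)]
  simp only [h1, h2, Finset.prod_mul_distrib]
  rw [h3 s fun i => pathProd s c (q + 1) (.inn i 0), mul_comm]

/-- The parameters are determined by the algebra. -/
theorem parameters_of_algEquiv (ad : Admissible k s) (ad' : Admissible k' s') (hθ : θ ≠ 0)
    (hθ' : θ' ≠ 0) (φ : LamRing K p q k s θ ≃ₐ[K] LamRing K p' q' k' s' θ') :
    (p = p' ∧ q = q' ∧ k = k' ∧ (s : ZMod k) = s' ∧ θ' = θ) ∨
      (p = q' ∧ q = p' ∧ k = k' ∧ ((s : ZMod k) + 1) * (s' + 1) = 1 ∧ θ' = θ⁻¹) := by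
  obtain ⟨f, c, hc⟩ := exists_incIso ad ad' hθ hθ' φ
  have hc1 := fun h hh => (hc h hh).1
  have hc2 := fun h hh => (hc h hh).2
  obtain ⟨rfl, hpq⟩ := f.card_eq
  have hL : ∏ i : ZMod k, pathProd s c (p + q + 2) (.out (i + 1) 0) ≠ 0 :=
    Finset.prod_ne_zero_iff.2 fun i _ => pathProd_ne_zero c hc1 _ rfl
  have hprod := prod_pathProd (s := s) ad.two_le c
  rcases f.exists_eq_zero (.inn 0 0) (.inl ⟨0, rfl⟩) with ⟨x, h⟩ | ⟨x, h⟩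
  · have hinv : f.symm.toFun (.inn x 0) = .inn 0 0 := by
      rw [← h]; exact f.left_inv rfl
    have h1 := f.le_of_inn_inn ad.two_le h
    have h2 := f.symm.le_of_inn_inn ad.two_le hinv
    obtain rfl : q = q' := le_antisymm h2 h1
    obtain rfl : p = p' := by omega
    obtain ⟨hs, hf⟩ := f.map_inn_of_inn ad h
    refine .inl ⟨rfl, rfl, rfl, hs, ?_⟩
    have h3 (i : ZMod k) := eq_of_inn_inn ad ad' hθ' rfl φ f c hc2 (hf i) (by
      rcases f.eq_pair i with ⟨j, h4, h5⟩ | ⟨j, -, h5⟩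
      · rw [hf, Inc.inn.injEq] at h4
        rw [h5, h4.1]
      · rw [hf] at h5; cases h5)
    have h4 := Finset.prod_congr (rfl : (Finset.univ : Finset (ZMod k)) = _) fun i _ => h3 i
    have h5 : ∏ i, edgeScalar θ' (x + i) = ∏ i, edgeScalar θ' i :=
      (Equiv.addLeft x).bijective.prod_comp (edgeScalar θ')
    rw [Finset.prod_mul_distrib, Finset.prod_mul_distrib, hprod, prod_edgeScalar, h5, prod_edgeScalar, mul_comm] at h4
    exact mul_right_cancel₀ hL h4
  · have hinv : f.symm.toFun (.out x 0) = .inn 0 0 := by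
      rw [← h]; exact f.left_inv rfl
    have h1 := f.le_of_inn_out ad.two_le h
    have h2 := f.symm.le_of_out_inn hinv
    obtain rfl : q = p' := le_antisymm h2 h1
    obtain rfl : p = q' := by omega
    obtain ⟨hs, w, hw, hf⟩ := f.map_inn_of_out ad ad' h
    refine .inr ⟨rfl, rfl, rfl, hs, ?_⟩
    have h3 (i : ZMod k) := eq_of_inn_out ad ad' hθ' hpq φ f c hc2 (i := i) (j := x + i * w - 1)
      (by rw [hf, sub_add_cancel]) (by
        rcases f.eq_pair i with ⟨j, h4, -⟩ | ⟨j, h4, h5⟩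
        · rw [hf] at h4; cases h4
        · rw [hf, Inc.out.injEq] at h5
          rw [h4, h5.1, add_sub_cancel_right])
    have h4 := Finset.prod_congr (rfl : (Finset.univ : Finset (ZMod k)) = _) fun i _ => h3 i
    -- Every edge e_j of the target cycle occurs once, so the product of the scalars there is θ'.
    have hbij : Function.Bijective fun i : ZMod k => x + i * w - 1 := by
      refine Finite.injective_iff_bijective.1 fun i j hij => hw.mul_right_cancel ?_
      exact add_left_cancel (sub_left_injective hij)
    rw [Finset.prod_mul_distrib, Finset.prod_mul_distrib, hprod, prod_edgeScalar,
      hbij.prod_comp (edgeScalar θ'), prod_edgeScalar, mul_right_comm] at h4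
    have h5 : θ * θ' = 1 := mul_right_cancel₀ hL (h4.symm.trans (one_mul _).symm)
    exact eq_inv_of_mul_eq_one_right h5

end BrauerT

namespace BrauerT

/-! ### Interchanging the inner and the outer edges -/

section Swap

variable {p q k s s' : ℕ}

/-- The incidences after inner and outer edges have been interchanged. -/
def Inc.swap (s' : ℕ) : Inc p q k → Inc q p k
  -- The slope -(s'+1) and the shift by s' in the `out` case match the two ends of each e_i. The
  -- constant s'+3 makes `inn 1 0` and `out 2 0` change places, so that e_1 goes to e_1.
  | .inn i j => .out (s' + 3 - (s' + 1) * i) j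
  | .out i j => .inn (s' + 3 - (s' + 1) * i + s') j
  | .innEnd i l => .outEnd (s' + 3 - (s' + 1) * i) l
  | .outEnd i r => .innEnd (s' + 3 - (s' + 1) * i + s') r

/-- The edges after inner and outer edges have been interchanged. -/
def Edge.swap (s' : ℕ) : Edge p q k → Edge q p k
  | .cyc i => .cyc (s' + 3 - (s' + 1) * i - 1)
  | .inner i l => .outer (s' + 3 - (s' + 1) * i) l
  | .outer i r => .inner (s' + 3 - (s' + 1) * i + s') r

theorem Inc.edge_swap (h : Inc p q k) : (h.swap s').edge = h.edge.swap s' := by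
  rcases h with ⟨i, j⟩ | ⟨i, j⟩ | ⟨i, l⟩ | ⟨i, r⟩
  · rcases Fin.eq_zero_or_eq_succ j with rfl | ⟨l, rfl⟩ <;> simp [Inc.swap, Edge.swap]
  · rcases Fin.eq_zero_or_eq_succ j with rfl | ⟨l, rfl⟩ <;> simp [Inc.swap, Edge.swap]
    ring
  · rfl
  · rfl

theorem Inc.valency_swap (h : Inc p q k) : (h.swap s').valency = h.valency := by
  cases h <;> simp [Inc.swap, Inc.valency, add_comm p q]

/-- The hypothesis says -(s'+1)s = s': a shift of the index by s becomes a shift by s'. -/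
theorem Inc.swap_next (hk : 2 ≤ k) (hs : ((s : ZMod k) + 1) * (s' + 1) = 1) (h : Inc p q k) :
    (h.next s).swap s' = (h.swap s').next s' := by
  rcases h with ⟨i, j, hj⟩ | ⟨i, j, hj⟩ | ⟨i, l⟩ | ⟨i, r⟩
  · rcases (Nat.lt_succ_iff.1 hj).lt_or_eq with h | rfl
    · rw [next_inn_lt s i j h, swap, swap, next_out_lt _ _ j h]
    · rw [next_inn_last hk, swap, swap, next_out_last]
  · rcases (Nat.lt_succ_iff.1 hj).lt_or_eq with h | rfl
    · rw [next_out_lt s i j h, swap, swap, next_inn_lt _ _ j h]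
    · rw [next_out_last, swap, swap, next_inn_last hk]
      congr 1
      linear_combination -hs
  · rw [next_innEnd, swap, swap, next_outEnd]
    congr 1
    linear_combination -hs
  · rw [next_outEnd, swap, swap, next_innEnd]
    congr 1
    linear_combination -hs

theorem Inc.swap_swap (hs : ((s : ZMod k) + 1) * (s' + 1) = 1) (h : Inc p q k) :
    (h.swap s').swap s = h := by
  rcases h with ⟨i, j⟩ | ⟨i, j⟩ | ⟨i, l⟩ | ⟨i, r⟩ <;> simp only [swap] <;> congr 1 <;>
    first | linear_combination (i - 1) * hs | linear_combination (i - 2) * hs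

theorem Edge.swap_swap (hs : ((s : ZMod k) + 1) * (s' + 1) = 1) (e : Edge p q k) :
    (e.swap s').swap s = e := by
  rcases e with i | ⟨i, l⟩ | ⟨i, r⟩ <;> simp only [swap] <;> congr 1 <;>
    first | linear_combination (i - 1) * hs | linear_combination (i - 2) * hs

theorem pathProd_swap (hk : 2 ≤ k) (hs : ((s : ZMod k) + 1) * (s' + 1) = 1) {B : Type*}
    [Monoid B] (a : Inc q p k → B) (m : ℕ) (h : Inc p q k) :
    pathProd s (fun g => a (g.swap s')) m h = pathProd s' a m (h.swap s') := by
  induction m generalizing h with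
  | zero => rfl
  | succ m ih => rw [pathProd, ih, Inc.swap_next hk hs, pathProd]

variable {K : Type*} [Field K] [NeZero k] {θ θ' : K}

/-- The images of the generators under the isomorphism which interchanges the inner and the outer
edges. -/
noncomputable def swapData (hk : 2 ≤ k) (hs : ((s : ZMod k) + 1) * (s' + 1) = 1)
    (hθ : θ * θ' = 1) : LamData K p q k s θ (LamRing K q p k s' θ') :=
  have hs' : ((s' : ZMod k) + 1) * (s + 1) = 1 := (mul_comm _ _).trans hs
  { e := fun v => LamData.gen.e (v.swap s')
    a := fun h => LamData.gen.a (h.swap s')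
    idem := fun v => LamData.gen.idem _
    orth := fun v w h => LamData.gen.orth _ _ fun e => h <| by
      rw [← Edge.swap_swap hs v, e, Edge.swap_swap hs]
    one := by
      let σ : Edge p q k ≃ Edge q p k :=
        ⟨Edge.swap s', Edge.swap s, Edge.swap_swap hs, Edge.swap_swap hs'⟩
      exact (σ.sum_comp LamData.gen.e).trans LamData.gen.one
    source := fun h => by rw [← Inc.edge_swap, LamData.gen.source]
    target := fun h => by rw [← Inc.edge_swap, Inc.swap_next hk hs, LamData.gen.target]
    zero := fun h h' _ hne => LamData.gen.mul_eq_zero_of_next_ne fun e => hne <| by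
      rw [← Inc.swap_next hk hs] at e
      rw [← Inc.swap_swap hs (h.next s), e, Inc.swap_swap hs]
    comm := fun h h' he hne h1 => by
      rw [pathProd_swap hk hs, pathProd_swap hk hs, ← Inc.valency_swap (s' := s') h,
        ← Inc.valency_swap (s' := s') h']
      refine LamData.gen.comm _ _ (by rw [Inc.edge_swap, Inc.edge_swap, he]) (fun e => hne ?_)
        fun e => h1 ?_
      · rw [← Inc.swap_swap hs h, e, Inc.swap_swap hs]
      · rw [Inc.edge_swap] at e
        rw [← Edge.swap_swap hs h.edge, e, Edge.swap]
        congr 1; ring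
    comm_one := by
      have e1 : (.inn 1 0 : Inc p q k).swap s' = .out (1 + 1) 0 := by
        rw [Inc.swap]; congr 1; ring
      have e2 : (.out (1 + 1) 0 : Inc p q k).swap s' = .inn 1 0 := by
        rw [Inc.swap]; congr 1; ring
      rw [pathProd_swap hk hs, pathProd_swap hk hs, e1, e2, add_comm p q, LamData.gen.comm_one,
        smul_smul, hθ, one_smul] }

/-- The isomorphism which interchanges the inner and the outer edges. -/
noncomputable def swapEquiv (hk : 2 ≤ k) (hs : ((s : ZMod k) + 1) * (s' + 1) = 1)
    (hθ : θ * θ' = 1) : LamRing K p q k s θ ≃ₐ[K] LamRing K q p k s' θ' :=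
  have hs' : ((s' : ZMod k) + 1) * (s + 1) = 1 := (mul_comm _ _).trans hs
  have hθ' : θ' * θ = 1 := (mul_comm _ _).trans hθ
  AlgEquiv.ofAlgHom (swapData hk hs hθ).lift (swapData hk hs' hθ').lift
    (LamData.gen_hom_ext (by simp [swapData, Edge.swap_swap hs'])
      (by simp [swapData, Inc.swap_swap hs']))
    (LamData.gen_hom_ext (by simp [swapData, Edge.swap_swap hs])
      (by simp [swapData, Inc.swap_swap hs]))

end Swap

/-! ### The parameters -/

theorem Admissible.of_gcd {k s : ℕ} (hk : 2 ≤ k) (h1 : Nat.gcd s k = 1)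
    (h2 : Nat.gcd (s + 2) k = 1) : Admissible k s where
  two_le := hk
  isUnit := (ZMod.isUnit_iff_coprime s k).2 h1
  isUnit_add_two := by
    have := (ZMod.isUnit_iff_coprime (s + 2) k).2 h2
    push_cast at this
    exact this

theorem natCast_mInt_mul {k s : ℕ} (hk : 2 ≤ k) (h : Nat.gcd (s + 2) k = 1) :
    (mInt k s : ZMod k) * (s + 2) + 1 = 0 := by
  have := (ZMod.natCast_eq_natCast_iff _ _ _).2 (mInt_spec hk h).2.2
  push_cast at this
  exact this

/-- In ℤ/k one has m = -1/(s+2) and m' = -1/(s'+2). Multiplying m + m' + 1 = 0 by (s+2)(s'+2) gives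
(s+1)(s'+1) = 1. -/
theorem mInt_add_mInt_eq_iff {k s s' : ℕ} (hk : 2 ≤ k) (h : Nat.gcd (s + 2) k = 1)
    (h' : Nat.gcd (s' + 2) k = 1) (hu : IsUnit ((s : ZMod k) + 2))
    (hu' : IsUnit ((s' : ZMod k) + 2)) :
    mInt k s + mInt k s' = k - 1 ↔ ((s : ZMod k) + 1) * (s' + 1) = 1 := by
  have e := natCast_mInt_mul hk h
  have e' := natCast_mInt_mul hk h'
  obtain ⟨h1, h2, -⟩ := mInt_spec hk h
  obtain ⟨h1', h2', -⟩ := mInt_spec hk h'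
  constructor
  · intro hm
    have h3 : ((mInt k s + mInt k s' + 1 : ℕ) : ZMod k) = 0 := by
      rw [show mInt k s + mInt k s' + 1 = k by omega, ZMod.natCast_self]
    push_cast at h3
    linear_combination ((s : ZMod k) + 2) * (s' + 2) * h3 - (s' + 2 : ZMod k) * e -
      (s + 2 : ZMod k) * e'
  · intro hs
    have h3 : ((mInt k s + mInt k s' + 1 : ℕ) : ZMod k) = 0 := by
      refine (hu.mul hu').mul_left_cancel ?_
      push_cast
      linear_combination hs + (s' + 2 : ZMod k) * e + (s + 2 : ZMod k) * e'
    obtain ⟨d, hd⟩ := (ZMod.natCast_eq_zero_iff _ _).1 h3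
    -- The bounds on both integers put their sum plus 1 strictly between 0 and 2k.
    have : d = 1 := by
      have : d < 2 := by by_contra! h4; have := Nat.mul_le_mul_left k h4; omega
      have : d ≠ 0 := by rintro rfl; omega
      omega
    subst this
    omega

end BrauerT

theorem mainTheorem12 (K : Type*) [Field K] [IsAlgClosed K]
    (p q k s p' q' k' s' : ℕ) [NeZero k] [NeZero k'] (θ θ' : K)
    (hk : 2 ≤ k) (hs1 : 1 ≤ s) (hs2 : s ≤ k - 1)
    (hgcd : Nat.gcd s k = 1) (hgcd2 : Nat.gcd (s + 2) k = 1) (hθ : θ ≠ 0)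
    (hk' : 2 ≤ k') (hs1' : 1 ≤ s') (hs2' : s' ≤ k' - 1)
    (hgcd' : Nat.gcd s' k' = 1) (hgcd2' : Nat.gcd (s' + 2) k' = 1) (hθ' : θ' ≠ 0) :
    Nonempty (Lam K p q k s θ ≃ₐ[K] Lam K p' q' k' s' θ') ↔
      ((p = p' ∧ q = q' ∧ k = k' ∧ s = s' ∧ θ' = θ) ∨
       (p = q' ∧ q = p' ∧ k = k' ∧ s ≠ s' ∧ mInt k s + mInt k' s' = k - 1 ∧ θ' = θ⁻¹)) := by
  have ad := BrauerT.Admissible.of_gcd hk hgcd hgcd2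
  have ad' := BrauerT.Admissible.of_gcd hk' hgcd' hgcd2'
  constructor
  · rintro ⟨φ⟩
    have φ' : BrauerT.LamRing K p q k s θ ≃ₐ[K] BrauerT.LamRing K p' q' k' s' θ' := φ
    rcases BrauerT.parameters_of_algEquiv ad ad' hθ hθ' φ' with
      ⟨rfl, rfl, rfl, hs, h⟩ | ⟨rfl, rfl, rfl, hs, h⟩
    · refine .inl ⟨rfl, rfl, rfl, ?_, h⟩
      exact Nat.ModEq.eq_of_lt_of_lt ((ZMod.natCast_eq_natCast_iff _ _ _).1 hs) (by omega) (by omega)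
    · refine .inr ⟨rfl, rfl, rfl, ?_, ?_, h⟩
      · rintro rfl
        have : Fact (1 < k) := ⟨hk⟩
        -- For s = s' the equation (s+1)² = 1 says s(s+2) = 0, but both factors are units.
        refine (ad.isUnit.mul ad.isUnit_add_two).ne_zero ?_
        linear_combination hs
      · exact (BrauerT.mInt_add_mInt_eq_iff hk hgcd2 hgcd2' ad.isUnit_add_two ad'.isUnit_add_two).2 hs
  · rintro (⟨rfl, rfl, rfl, rfl, rfl⟩ | ⟨rfl, rfl, rfl, -, hm, rfl⟩)
    · exact ⟨AlgEquiv.refl⟩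
    · have hs := (BrauerT.mInt_add_mInt_eq_iff hk hgcd2 hgcd2' ad.isUnit_add_two ad'.isUnit_add_two).1 hm
      have φ : BrauerT.LamRing K p q k s θ ≃ₐ[K] BrauerT.LamRing K q p k s' θ⁻¹ :=
        BrauerT.swapEquiv hk hs (mul_inv_cancel₀ hθ)
      exact ⟨φ⟩
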